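/- Let $(\Omega,\mathcal F,\mathbb P)$ be a probability space, $X:\Omega\to\mathbb R^d$ and $Y:\Omega\to\mathbb R^p$ random variables, $f:\mathbb R^p\to\mathbb R$ measurable with $\mathbb E[f(Y)^2]<\infty$, and $(\varphi(\theta,\cdot))_{\theta\in\mathbb R^q}$ a family of measurable functions $\mathbb R^d\to\mathbb R$ with $\mathbb E[\varphi(\theta,X)^2]<\infty$ for all $\theta$. Let $(X_i)_{i\ge1}$ be iid with the law of $X$ and, given $X_i$, let $(Y_i^{(k)})_{k\ge1}$ be iid with the conditional law $\mathcal L(Y\mid X=X_i)$, the blocks $(X_i,(Y_i^{(k)})_{k\ge1})$, $i\ge1$, being independent. Put $$v^\infty(\theta)=\mathbb E\big[(\varphi(\theta,X)-\mathbb E[f(Y)|X])^2\big],\qquad v_N^K(\theta)=\frac1N\sum_{i=1}^N\Big(\varphi(\theta,X_i)-\frac1K\sum_{k=1}^Kf(Y_i^{(k)})\Big)^2 .$$ Let $C\subset\mathbb R^q$ be compact with interior $\mathring C$, and let gradients $\nabla$ and Hessians $\nabla^2$ be taken with respect to $\theta$. Assume: 1. $\mathbb E[\sup_{\theta\in C}|\varphi(\theta,X)|^2]<\infty$;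 2. for almost every $x$ with respect to the law of $X$, $\theta\mapsto\varphi(\theta,x)$ is continuous on $C$; 3. $v^\infty$ has on $C$ a unique minimizer $\theta^\star$, and $\theta^\star\in\mathring C$; 4. for almost every $x$ with respect to the law of $X$, $\theta\mapsto\varphi(\theta,x)$ is twice continuously differentiable on $\mathring C$, and $\mathbb E[\sup_{\theta\in\mathring C}|\nabla\varphi(\theta,X)|^2]<\infty$, $\mathbb E[\sup_{\theta\in\mathring C}|\nabla^2\varphi(\theta,X)|^2]<\infty$. Fix $K\ge1$ and assume that $\mathbb E\big[\big(\varphi(\theta^\star,X_1)-\frac1K\sum_{k=1}^Kf(Y_1^{(k)})\big)^2|\nabla\varphi(\theta^\star,X_1)|^2\big]<\infty$ and that the matrix $H:=\nabla^2v^\infty(\theta^\star)$ is positive definite. For each $N\ge1$ let $\theta_N^K$ be a random variable which almost surely belongs to $C$ and minimizes $v_N^K$ over $C$. Then the matrices $$A=\mathbb E\big[(\varphi(\theta^\star,X)-\mathbb E[f(Y)|X])^2\,\nabla\varphi(\theta^\star,X)\nabla\varphi(\theta^\star,X)^T\big],\qquad B=\mathbb E\big[(f(Y)-\mathbb E[f(Y)|X])^2\,\nabla\varphi(\theta^\star,X)\nabla\varphi(\theta^\star,X)^T\big]$$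 are well defined (the entries are integrable) and positive semidefinite and, with $\Gamma^K=A+B/K$, as $N\to\infty$, $$\sqrt N(\theta_N^K-\theta^\star)\xrightarrow{\ \mathcal L\ }\mathcal N(0,4H^{-1}\Gamma^KH^{-1}),$$ $$N\big(v^\infty(\theta_N^K)-v^\infty(\theta^\star)\big)\xrightarrow{\ \mathcal L\ }2G^THG,\qquad G\sim\mathcal N(0,H^{-1}\Gamma^KH^{-1}).$$ -/

import Mathlib

open MeasureTheory ProbabilityTheory Filter Topology
open scoped Matrix

noncomputable section

/-- The conditional expectation `E[f(Y) | X]`, as a random variable on `Ω`. -/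
def condMean {Ω : Type*} [MeasurableSpace Ω] (P : Measure Ω) {d p : ℕ}
    (X : Ω → EuclideanSpace ℝ (Fin d)) (Y : Ω → EuclideanSpace ℝ (Fin p))
    (f : EuclideanSpace ℝ (Fin p) → ℝ) : Ω → ℝ :=
  P[fun ω => f (Y ω) | MeasurableSpace.comap X inferInstance]

/-- The limiting criterion `v^∞(θ) = E[(φ(θ, X) - E[f(Y) | X])²]`. -/
def vInf {Ω : Type*} [MeasurableSpace Ω] (P : Measure Ω) {d p q : ℕ}
    (X : Ω → EuclideanSpace ℝ (Fin d)) (Y : Ω → EuclideanSpace ℝ (Fin p))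
    (f : EuclideanSpace ℝ (Fin p) → ℝ)
    (φ : EuclideanSpace ℝ (Fin q) → EuclideanSpace ℝ (Fin d) → ℝ)
    (θ : EuclideanSpace ℝ (Fin q)) : ℝ :=
  ∫ ω, (φ θ (X ω) - condMean P X Y f ω) ^ 2 ∂P

/-- The residual `φ(θ, x) - (1/K) ∑_{k=1}^K f(y^{(k)})`; inner samples are numbered from `0`. -/
def nestedResidual {d p q : ℕ} (f : EuclideanSpace ℝ (Fin p) → ℝ)
    (φ : EuclideanSpace ℝ (Fin q) → EuclideanSpace ℝ (Fin d) → ℝ) (K : ℕ)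
    (θ : EuclideanSpace ℝ (Fin q)) (x : EuclideanSpace ℝ (Fin d))
    (y : ℕ → EuclideanSpace ℝ (Fin p)) : ℝ :=
  φ θ x - (1 / (K : ℝ)) * ∑ k ∈ Finset.range K, f (y k)

/-- The empirical criterion
`v_N^K(θ) = (1/N) ∑_{i=1}^N (φ(θ, x_i) - (1/K) ∑_{k=1}^K f(y_i^{(k)}))²` for given sample
values; outer and inner samples are numbered from `0`. -/
def vEmp {d p q : ℕ} (f : EuclideanSpace ℝ (Fin p) → ℝ)
    (φ : EuclideanSpace ℝ (Fin q) → EuclideanSpace ℝ (Fin d) → ℝ) (K N : ℕ)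
    (x : ℕ → EuclideanSpace ℝ (Fin d)) (y : ℕ → ℕ → EuclideanSpace ℝ (Fin p))
    (θ : EuclideanSpace ℝ (Fin q)) : ℝ :=
  (1 / (N : ℝ)) * ∑ i ∈ Finset.range N, nestedResidual f φ K θ (x i) (y i) ^ 2

/-- The nested sampling scheme: the blocks `(X_i, (Y_i^{(k)})_k)` are independent, each `X_i` has
the law of `X`, and given `X_i` the variables `Y_i^{(k)}` are independent with law
`L(Y | X = X_i)`. The law of a block is given by its finite-dimensional values on rectangles,
`condDistrib Y X P` being the regular conditional law `x ↦ L(Y | X = x)`. -/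
structure IsNestedSample {Ω : Type*} [MeasurableSpace Ω] (P : Measure Ω) [IsProbabilityMeasure P]
    {d p : ℕ} (X : Ω → EuclideanSpace ℝ (Fin d)) (Y : Ω → EuclideanSpace ℝ (Fin p))
    (Xs : ℕ → Ω → EuclideanSpace ℝ (Fin d)) (Ys : ℕ → ℕ → Ω → EuclideanSpace ℝ (Fin p)) :
    Prop where
  measurable_outer : ∀ i, Measurable (Xs i)
  measurable_inner : ∀ i k, Measurable (Ys i k)
  block_law : ∀ (i n : ℕ) (s : Set (EuclideanSpace ℝ (Fin d)))
    (t : ℕ → Set (EuclideanSpace ℝ (Fin p))), MeasurableSet s → (∀ k, MeasurableSet (t k)) →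
    P {ω | Xs i ω ∈ s ∧ ∀ k < n, Ys i k ω ∈ t k} =
      ∫⁻ x in s, ∏ k ∈ Finset.range n, condDistrib Y X P x (t k) ∂(P.map X)
  indep : iIndepFun (fun i ω => (Xs i ω, fun k => Ys i k ω)) P

/-- The Hessian matrix `∇²g(θ)` of second partial derivatives. -/
def hessianMatrix {q : ℕ} (g : EuclideanSpace ℝ (Fin q) → ℝ) (θ : EuclideanSpace ℝ (Fin q)) :
    Matrix (Fin q) (Fin q) ℝ :=
  Matrix.of fun i j =>
    iteratedFDeriv ℝ 2 g θ ![EuclideanSpace.single i 1, EuclideanSpace.single j 1]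

/-- The random matrix `w² ∇φ(θ, X) ∇φ(θ, X)ᵀ` for a real random variable `w`. -/
def weightedGram {Ω : Type*} {d q : ℕ} (X : Ω → EuclideanSpace ℝ (Fin d))
    (φ : EuclideanSpace ℝ (Fin q) → EuclideanSpace ℝ (Fin d) → ℝ)
    (θ : EuclideanSpace ℝ (Fin q)) (w : Ω → ℝ) (ω : Ω) : Matrix (Fin q) (Fin q) ℝ :=
  Matrix.of fun i j =>
    w ω ^ 2 * (gradient (fun ϑ => φ ϑ (X ω)) θ i * gradient (fun ϑ => φ ϑ (X ω)) θ j)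

/-- Entrywise expectation of a random matrix. -/
def expectMatrix {Ω : Type*} [MeasurableSpace Ω] (P : Measure Ω) {q : ℕ}
    (M : Ω → Matrix (Fin q) (Fin q) ℝ) : Matrix (Fin q) (Fin q) ℝ :=
  Matrix.of fun i j => ∫ ω, M ω i j ∂P

/-- `A = E[(φ(θ, X) - E[f(Y) | X])² ∇φ(θ, X) ∇φ(θ, X)ᵀ]` is the expectation of this matrix. -/
def randA {Ω : Type*} [MeasurableSpace Ω] (P : Measure Ω) {d p q : ℕ}
    (X : Ω → EuclideanSpace ℝ (Fin d)) (Y : Ω → EuclideanSpace ℝ (Fin p))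
    (f : EuclideanSpace ℝ (Fin p) → ℝ)
    (φ : EuclideanSpace ℝ (Fin q) → EuclideanSpace ℝ (Fin d) → ℝ)
    (θ : EuclideanSpace ℝ (Fin q)) : Ω → Matrix (Fin q) (Fin q) ℝ :=
  weightedGram X φ θ fun ω => φ θ (X ω) - condMean P X Y f ω

/-- `B = E[(f(Y) - E[f(Y) | X])² ∇φ(θ, X) ∇φ(θ, X)ᵀ]` is the expectation of this matrix. -/
def randB {Ω : Type*} [MeasurableSpace Ω] (P : Measure Ω) {d p q : ℕ}
    (X : Ω → EuclideanSpace ℝ (Fin d)) (Y : Ω → EuclideanSpace ℝ (Fin p))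
    (f : EuclideanSpace ℝ (Fin p) → ℝ)
    (φ : EuclideanSpace ℝ (Fin q) → EuclideanSpace ℝ (Fin d) → ℝ)
    (θ : EuclideanSpace ℝ (Fin q)) : Ω → Matrix (Fin q) (Fin q) ℝ :=
  weightedGram X φ θ fun ω => f (Y ω) - condMean P X Y f ω

end

/-! The estimator is an M-estimator for the criterion
$h(\theta,(x,y))=(\varphi(\theta,x)-\frac1K\sum_k f(y_k))^2$ under the law $\mu$ of one block, that
is, the law of $X$ followed by $K$ conditionally independent draws of $Y$. Conditionally on $x$, the
bias-variance identity gives $\int h(\theta,\cdot)\,d\mu=v^\infty(\theta)+c$ with $c$ free of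
$\theta$. Inner averaging therefore changes neither the minimizer nor the Hessian, and finite $K$ is
felt only in the fluctuations.

The general theory is `IsRegularCriterion.tendstoInDistribution_minimizer`. A law of large numbers
uniform on small balls (`IsIIDSample.sampleMean_near`) gives consistency by compactness. Applied to
second derivatives, it linearizes the first order condition: almost surely
$H(\hat\theta_N-\theta^\star)+\frac1N\sum_i\nabla
h(\theta^\star,Z_i)=o(|\hat\theta_N-\theta^\star|)$. The remainder is relative to the error itself,
so no rate has to be known beforehand. The error is asymptotically equivalent to a mean of iid
centered vectors $-H^{-1}\nabla h(\theta^\star,Z_i)$, and the central limit theorem yields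
covariance $H^{-1}QH^{-1}$ with $Q=\int\nabla h\nabla h^T\,d\mu$. A second order Taylor expansion at
the critical point $\theta^\star$ gives the law of the excess criterion.

Since $\nabla h=2\rho\nabla\varphi$ for the residual $\rho$, the bias-variance identity weighted by
$\partial_i\varphi\,\partial_j\varphi$ (`integral_nested_sq_mul`) gives $Q=4(A+B/K)$. -/

/-! ### Negligible perturbations and the multivariate central limit theorem. -/

section ConvergenceInDistribution

/-- Portmanteau: the boundary of $\{|x|\ge\varepsilon\}$ lies in $\{|x|=\varepsilon\}$, which the
Dirac mass at $0$ does not charge. -/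
lemma tendstoInMeasure_zero_of_tendstoInDistribution_zero {Ω Ω' : Type*} [MeasurableSpace Ω]
    [MeasurableSpace Ω'] {P : Measure Ω} [IsProbabilityMeasure P] {P' : Measure Ω'}
    [IsProbabilityMeasure P'] {Y : ℕ → Ω → ℝ}
    (h : TendstoInDistribution Y atTop (fun _ : Ω' => (0 : ℝ)) (fun _ => P) P') :
    TendstoInMeasure P Y atTop 0 := by
  rw [tendstoInMeasure_iff_norm]
  intro ε hε
  have hfr : frontier {x : ℝ | ε ≤ ‖x‖} ⊆ {x | ‖x‖ = ε} := by
    refine (frontier_le_subset_eq continuous_const continuous_norm).trans ?_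
    intro x hx; exact (Set.mem_ofPred.1 hx).symm
  have hcl : IsClosed {x : ℝ | ε ≤ ‖x‖} := isClosed_le continuous_const continuous_norm
  have h1 := ProbabilityMeasure.tendsto_measure_of_null_frontier_of_tendsto' h.tendsto
    (E := {x : ℝ | ε ≤ ‖x‖}) (by
      simp only [ProbabilityMeasure.coe_mk, Measure.map_const, measure_univ, one_smul]
      refine measure_mono_null hfr ?_
      rw [Measure.dirac_apply' _ (measurableSet_eq_fun (by fun_prop) (by fun_prop))]
      simp [hε.ne])
  simp only [ProbabilityMeasure.coe_mk, Measure.map_const, measure_univ, one_smul] at h1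
  rw [Measure.dirac_apply' _ hcl.measurableSet] at h1
  simp only [Set.indicator, Set.mem_ofPred_eq, norm_zero, not_le.2 hε, if_false] at h1
  refine h1.congr fun n => ?_
  rw [Measure.map_apply_of_aemeasurable (h.forall_aemeasurable n) hcl.measurableSet]
  simp

/-- If `D n = o(T n)` almost surely and `T n` converges in distribution, then `D n` converges to
`0` in probability. -/
lemma tendstoInMeasure_zero_of_isLittleO {Ω Ω' F G : Type*} [MeasurableSpace Ω]
    [MeasurableSpace Ω'] {P : Measure Ω} [IsProbabilityMeasure P] {P' : Measure Ω'}
    [IsProbabilityMeasure P'] [NormedAddCommGroup F] [MeasurableSpace F] [BorelSpace F]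
    [NormedAddCommGroup G] [MeasurableSpace G] [BorelSpace G]
    [SecondCountableTopology F]
    {T : ℕ → Ω → F} {D : ℕ → Ω → G} {Z : Ω' → F}
    (hT : TendstoInDistribution T atTop Z (fun _ => P) P') (hD : ∀ n, AEMeasurable (D n) P)
    (ho : ∀ᵐ ω ∂P, (fun n => D n ω) =o[atTop] fun n => T n ω) :
    TendstoInMeasure P D atTop 0 := by
  have hTm := hT.forall_aemeasurable
  have hρm : ∀ n, AEMeasurable (fun ω => ‖D n ω‖ / ‖T n ω‖) P := fun n =>
    (hD n).norm.div (hTm n).norm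
  have hρ : TendstoInMeasure P (fun n ω => ‖D n ω‖ / ‖T n ω‖) atTop (fun _ => (0 : ℝ)) := by
    refine tendstoInMeasure_of_tendsto_ae (fun n => (hρm n).aestronglyMeasurable) ?_
    filter_upwards [ho] with ω hω
    exact hω.norm_norm.tendsto_div_nhds_zero
  -- Slutsky: a sequence converging in law times a ratio tending to $0$ in probability.
  have h1 : TendstoInDistribution (fun n ω => ‖T n ω‖ * (‖D n ω‖ / ‖T n ω‖)) atTop
      (fun _ : Ω' => (0 : ℝ)) (fun _ => P) P' := by
    have := hT.continuous_comp_prodMk_of_tendstoInMeasure_const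
      (g := fun p : F × ℝ => ‖p.1‖ * p.2) (by fun_prop) hρ hρm
    simpa using this
  have h2 : TendstoInDistribution (fun n ω => ‖D n ω‖) atTop
      (fun _ : Ω' => (0 : ℝ)) (fun _ => P) P' := by
    refine tendstoInDistribution_of_tendstoInMeasure_sub _ _ h1 ?_ (fun n => (hD n).norm)
    refine tendstoInMeasure_of_tendsto_ae (fun n =>
      ((hD n).norm.sub ((hTm n).norm.mul (hρm n))).aestronglyMeasurable) ?_
    filter_upwards [ho] with ω hω
    refine tendsto_const_nhds.congr' ?_
    filter_upwards [hω.def one_pos] with n hn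
    simp only [Pi.zero_apply, Pi.sub_apply]
    -- Division by zero is harmless: where $T_n$ vanishes, the bound $|D_n|\le|T_n|$ makes $D_n$
    -- vanish too.
    by_cases h0 : ‖T n ω‖ = 0
    · have : ‖D n ω‖ = 0 := le_antisymm (by simpa [h0] using hn) (norm_nonneg _)
      simp [h0, this]
    · field_simp
      simp
  have h3 := tendstoInMeasure_zero_of_tendstoInDistribution_zero h2
  rw [tendstoInMeasure_iff_norm] at h3 ⊢
  simpa using h3

/-- Convergence in distribution is stable under almost sure perturbations which are negligible
with respect to the sequence. -/
lemma MeasureTheory.TendstoInDistribution.of_isLittleO_sub {Ω Ω' F : Type*} [MeasurableSpace Ω]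
    [MeasurableSpace Ω'] {P : Measure Ω} [IsProbabilityMeasure P] {P' : Measure Ω'}
    [IsProbabilityMeasure P'] [NormedAddCommGroup F] [MeasurableSpace F] [BorelSpace F]
    [SecondCountableTopology F] {T Y : ℕ → Ω → F} {Z : Ω' → F}
    (hT : TendstoInDistribution T atTop Z (fun _ => P) P') (hY : ∀ n, AEMeasurable (Y n) P)
    (ho : ∀ᵐ ω ∂P, (fun n => Y n ω - T n ω) =o[atTop] fun n => T n ω) :
    TendstoInDistribution Y atTop Z (fun _ => P) P' :=
  tendstoInDistribution_of_tendstoInMeasure_sub _ _ hT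
    (tendstoInMeasure_zero_of_isLittleO hT
      (fun n => (hY n).sub (hT.forall_aemeasurable n)) ho) hY

/-- The multivariate central limit theorem for centered square integrable vectors. -/
theorem tendstoInDistribution_multivariateGaussian {Ω : Type*} [MeasurableSpace Ω]
    {P : Measure Ω} [IsProbabilityMeasure P] {q : ℕ} {ξ : ℕ → Ω → EuclideanSpace ℝ (Fin q)}
    (hind : iIndepFun ξ P) (hid : ∀ i, IdentDistrib (ξ i) (ξ 0) P P) (hL2 : MemLp (ξ 0) 2 P)
    (hmean : ∫ ω, ξ 0 ω ∂P = 0) {S : Matrix (Fin q) (Fin q) ℝ} (hS : S.PosSemidef)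
    (hcov : ∀ t : EuclideanSpace ℝ (Fin q), ∫ ω, inner ℝ (ξ 0 ω) t ^ 2 ∂P = t.ofLp ⬝ᵥ S *ᵥ t.ofLp) :
    TendstoInDistribution (fun (n : ℕ) ω => (√n)⁻¹ • ∑ i ∈ Finset.range n, ξ i ω) atTop
      (fun g : EuclideanSpace ℝ (Fin q) => g) (fun _ => P) (multivariateGaussian 0 S) := by
  have hm : ∀ i, AEMeasurable (ξ i) P := fun i => (hid i).aemeasurable_fst
  have hms : ∀ n : ℕ, AEMeasurable (fun ω => (√(n : ℝ))⁻¹ • ∑ i ∈ Finset.range n, ξ i ω) P :=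
    fun n => AEMeasurable.fun_const_smul (Finset.aemeasurable_fun_sum _ fun i _ => hm i) _
  refine ⟨hms, by fun_prop, ?_⟩
  refine ProbabilityMeasure.tendsto_iff_tendsto_charFun.2 fun t => ?_
  simp only [ProbabilityMeasure.coe_mk]
  have hint : Integrable (ξ 0) P := hL2.integrable (by norm_num)
  have hL2t : MemLp (fun ω => inner ℝ (ξ 0 ω) t) 2 P := hL2.inner_const t
  have hmt : P[fun ω => inner ℝ (ξ 0 ω) t] = 0 := by
    have := integral_inner (𝕜 := ℝ) hint t
    simp only [hmean, inner_zero_right] at this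
    rw [← this]
    simp_rw [real_inner_comm]
  have hvar : Var[fun ω => inner ℝ (ξ 0 ω) t; P] = t.ofLp ⬝ᵥ S *ᵥ t.ofLp := by
    rw [variance_of_integral_eq_zero hL2t.aestronglyMeasurable.aemeasurable hmt]
    exact hcov t
  have hinner : Measurable fun x : EuclideanSpace ℝ (Fin q) => inner ℝ x t := by fun_prop
  -- Cramér–Wold: the characteristic function of the vector at $t$ is that of its projection on $t$
  -- at $1$, so the scalar theorem suffices.
  have h1 := tendstoInDistribution_inv_sqrt_mul_sum_sub (P := P)
    (X := fun i ω => inner ℝ (ξ i ω) t) (Y := id) (P' := gaussianReal 0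
      (Var[fun ω => inner ℝ (ξ 0 ω) t; P]).toNNReal) ⟨aemeasurable_id, by simp⟩ hL2t
      (hind.comp (fun _ x => inner ℝ x t) fun _ => hinner)
      (fun i => (hid i).comp hinner)
  have h2 := ProbabilityMeasure.tendsto_iff_tendsto_charFun.1 h1.tendsto 1
  simp only [ProbabilityMeasure.coe_mk, Measure.map_id] at h2
  have h3 : charFun (gaussianReal 0 (Var[fun ω => inner ℝ (ξ 0 ω) t; P]).toNNReal) 1 =
      charFun ((multivariateGaussian 0 S).map fun g => g) t := by
    have hnn := variance_nonneg (fun ω => inner ℝ (ξ 0 ω) t) P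
    rw [Measure.map_id', charFun_multivariateGaussian hS, charFun_gaussianReal, ← hvar,
      Real.coe_toNNReal _ hnn]
    simp
  rw [h3] at h2
  refine h2.congr fun n => ?_
  rw [charFun_apply_real, charFun_apply, integral_map (hms n) (by fun_prop),
    integral_map _ (by fun_prop)]
  · congr 1
    ext ω
    rw [hmt, mul_zero, sub_zero, inner_smul_left, sum_inner]
    simp
  · rw [hmt]
    exact ((Finset.aemeasurable_fun_sum _ fun i _ => hinner.comp_aemeasurable (hm i)).sub_const
      _).const_mul _

end ConvergenceInDistribution

/-! ### Measurability of suprema and derivatives with respect to a parameter. -/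

section ParametricMeasurability

variable {S Θ G : Type*} [MeasurableSpace S] {μ : Measure S} [PseudoMetricSpace Θ]
  [SecondCountableTopology Θ]

/-- By continuity in $\theta$, a countable dense subset of $U$ already achieves the uncountable
supremum. -/
lemma aemeasurable_biSup_of_continuousOn {U : Set Θ} {g : Θ → S → ENNReal}
    (hm : ∀ θ ∈ U, AEMeasurable (g θ) μ) (hc : ∀ᵐ z ∂μ, ContinuousOn (fun θ => g θ z) U) :
    AEMeasurable (fun z => ⨆ θ ∈ U, g θ z) μ := by
  obtain ⟨T, hTU, hT, hUT⟩ :=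
    (TopologicalSpace.IsSeparable.of_separableSpace U).exists_countable_dense_subset
  refine (AEMeasurable.biSup T hT fun θ hθ => hm θ (hTU hθ)).congr ?_
  filter_upwards [hc] with z hz
  refine le_antisymm (biSup_mono fun θ hθ => hTU hθ) (iSup₂_le fun θ hθ => ?_)
  exact ContinuousWithinAt.closure_le (hUT hθ) ((hz θ hθ).mono hTU) continuousWithinAt_const
    fun y hy => le_biSup (fun θ => g θ z) hy

variable [NormedAddCommGroup G]

/-- The envelope is the square root of the supremum. A finite integral makes the supremum finite
almost everywhere, so passing to a real value with `toReal` preserves the bound there. -/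
lemma exists_memLp_two_bound {U : Set Θ} {F : Θ → S → G}
    (hm : ∀ θ ∈ U, AEStronglyMeasurable (F θ) μ)
    (hc : ∀ᵐ z ∂μ, ContinuousOn (fun θ => F θ z) U)
    (hfin : ∫⁻ z, ⨆ θ ∈ U, ENNReal.ofReal (‖F θ z‖ ^ 2) ∂μ < ⊤) :
    ∃ M : S → ℝ, MemLp M 2 μ ∧ (∀ z, 0 ≤ M z) ∧ ∀ᵐ z ∂μ, ∀ θ ∈ U, ‖F θ z‖ ≤ M z := by
  have hs : AEMeasurable (fun z => ⨆ θ ∈ U, ENNReal.ofReal (‖F θ z‖ ^ 2)) μ := by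
    refine aemeasurable_biSup_of_continuousOn
      (fun θ hθ => ((hm θ hθ).norm.aemeasurable.pow_const 2).ennreal_ofReal) ?_
    filter_upwards [hc] with z hz
    exact ENNReal.continuous_ofReal.comp_continuousOn (hz.norm.pow 2)
  refine ⟨fun z => √(⨆ θ ∈ U, ENNReal.ofReal (‖F θ z‖ ^ 2)).toReal, ?_,
    fun z => Real.sqrt_nonneg _, ?_⟩
  · rw [memLp_two_iff_integrable_sq hs.ennreal_toReal.sqrt.aestronglyMeasurable]
    simp only [Real.sq_sqrt ENNReal.toReal_nonneg]
    exact integrable_toReal_of_lintegral_ne_top hs hfin.ne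
  · filter_upwards [ae_lt_top' hs hfin.ne] with z hz θ hθ
    refine Real.le_sqrt_of_sq_le ?_
    rw [← ENNReal.ofReal_le_iff_le_toReal hz.ne]
    exact le_biSup (fun θ => ENNReal.ofReal (‖F θ z‖ ^ 2)) hθ

/-- Directional derivatives are almost everywhere limits of difference quotients, each measurable in
$z$; finitely many directions determine the derivative. No joint measurability in $(\theta,z)$ is
needed. -/
lemma aestronglyMeasurable_fderiv_param [NormedSpace ℝ G] {q : ℕ}
    {U : Set (EuclideanSpace ℝ (Fin q))} (hU : IsOpen U)
    {F : EuclideanSpace ℝ (Fin q) → S → G} {θ : EuclideanSpace ℝ (Fin q)} (hθ : θ ∈ U)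
    (hm : ∀ θ ∈ U, AEStronglyMeasurable (F θ) μ)
    (hd : ∀ᵐ z ∂μ, DifferentiableAt ℝ (fun θ => F θ z) θ) :
    AEStronglyMeasurable (fun z => fderiv ℝ (fun θ => F θ z) θ) μ := by
  have hv : ∀ v, AEStronglyMeasurable (fun z => fderiv ℝ (fun θ => F θ z) θ v) μ := by
    intro v
    have hlim : Tendsto (fun n : ℕ => θ + ((n : ℝ) + 1)⁻¹ • v) atTop (𝓝 θ) := by
      have h0 : Tendsto (fun n : ℕ => ((n : ℝ) + 1)⁻¹) atTop (𝓝 0) := by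
        simpa using tendsto_one_div_add_atTop_nhds_zero_nat (𝕜 := ℝ)
      simpa using (h0.smul_const v).const_add θ
    -- The shift by `n₀` keeps every evaluation point inside $U$, where measurability is assumed.
    obtain ⟨n₀, hn₀⟩ := eventually_atTop.1 (hlim.eventually (hU.mem_nhds hθ))
    refine aestronglyMeasurable_of_tendsto_ae atTop
      (f := fun (n : ℕ) z => (((n + n₀ : ℕ) : ℝ) + 1) •
        (F (θ + (((n + n₀ : ℕ) : ℝ) + 1)⁻¹ • v) z - F θ z)) (fun n => ?_) ?_
    · exact ((hm _ (hn₀ _ (Nat.le_add_left _ _))).sub (hm θ hθ)).const_smul _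
    · filter_upwards [hd] with z hz
      refine hz.hasFDerivAt.lim v (c := fun n : ℕ => ((n + n₀ : ℕ) : ℝ) + 1) ?_
      refine tendsto_norm_atTop_atTop.comp (tendsto_atTop_add_const_right _ _ ?_)
      exact tendsto_natCast_atTop_atTop.comp (tendsto_add_atTop_nat n₀)
  have hsum : ∀ L : EuclideanSpace ℝ (Fin q) →L[ℝ] G,
      L = ∑ i, ContinuousLinearMap.smulRightL ℝ (EuclideanSpace ℝ (Fin q)) G
        (EuclideanSpace.proj i) (L (EuclideanSpace.single i 1)) := by
    intro L
    ext x
    conv_lhs => rw [← (EuclideanSpace.basisFun (Fin q) ℝ).sum_repr x]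
    simp
  have h2 := Finset.aestronglyMeasurable_fun_sum (μ := μ) Finset.univ (f := fun i z =>
    ContinuousLinearMap.smulRightL ℝ (EuclideanSpace ℝ (Fin q)) G (EuclideanSpace.proj i)
      (fderiv ℝ (fun θ => F θ z) θ (EuclideanSpace.single i 1)))
    fun i _ => (ContinuousLinearMap.continuous _).comp_aestronglyMeasurable (hv _)
  refine h2.congr (Eventually.of_forall fun z => ?_)
  exact (hsum _).symm

end ParametricMeasurability

/-! ### Laws of large numbers for iid samples, pointwise and locally uniform. -/

section LawOfLargeNumbers

/-- `Z` is a sequence of independent random variables with common law `μ`. -/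
structure IsIIDSample {Ω S : Type*} [MeasurableSpace Ω] [MeasurableSpace S] (P : Measure Ω)
    (μ : Measure S) (Z : ℕ → Ω → S) : Prop where
  aemeasurable : ∀ i, AEMeasurable (Z i) P
  map_eq : ∀ i, P.map (Z i) = μ
  indep : iIndepFun Z P

/-- The mean of `g` over the first `n` points of the sample `z`. -/
noncomputable def sampleMean {S G : Type*} [AddCommGroup G] [Module ℝ G] (z : ℕ → S) (n : ℕ)
    (g : S → G) : G :=
  (n : ℝ)⁻¹ • ∑ i ∈ Finset.range n, g (z i)

lemma norm_sampleMean_sub_le {S G : Type*} [NormedAddCommGroup G] [NormedSpace ℝ G] {z : ℕ → S}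
    {n : ℕ} {g h : S → G} {w : S → ℝ} (hw : ∀ i, ‖g (z i) - h (z i)‖ ≤ w (z i)) :
    ‖sampleMean z n g - sampleMean z n h‖ ≤ sampleMean z n w := by
  rw [sampleMean, sampleMean, ← smul_sub, ← Finset.sum_sub_distrib, norm_smul, sampleMean,
    norm_inv, RCLike.norm_natCast, smul_eq_mul]
  gcongr
  exact norm_sum_le_of_le _ fun i _ => hw i

variable {Ω S : Type*} [MeasurableSpace Ω] [MeasurableSpace S] {P : Measure Ω}
    {μ : Measure S} {Z : ℕ → Ω → S}

lemma IsIIDSample.ae (hZ : IsIIDSample P μ Z) {p : S → Prop} (hp : ∀ᵐ z ∂μ, p z) :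
    ∀ᵐ ω ∂P, ∀ i, p (Z i ω) := by
  rw [ae_all_iff]
  intro i
  refine ae_of_ae_map (hZ.aemeasurable i) ?_
  rwa [hZ.map_eq i]

lemma IsIIDSample.identDistrib (hZ : IsIIDSample P μ Z) {G : Type*} [MeasurableSpace G] {g : S → G}
    (hg : AEMeasurable g μ) (i : ℕ) : IdentDistrib (fun ω => g (Z i ω)) (fun ω => g (Z 0 ω)) P P :=
  (⟨hZ.aemeasurable i, hZ.aemeasurable 0, by rw [hZ.map_eq, hZ.map_eq]⟩ :
    IdentDistrib (Z i) (Z 0) P P).comp_of_aemeasurable (by rwa [hZ.map_eq])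

lemma IsIIDSample.iIndepFun_comp (hZ : IsIIDSample P μ Z) {G : Type*} [MeasurableSpace G]
    {g : S → G} (hg : AEMeasurable g μ) : iIndepFun (fun i ω => g (Z i ω)) P :=
  hZ.indep.comp₀ (fun _ => g) hZ.aemeasurable fun i => by rwa [hZ.map_eq]

lemma IsIIDSample.integral_comp (hZ : IsIIDSample P μ Z) {G : Type*} [NormedAddCommGroup G]
    [NormedSpace ℝ G] {g : S → G} (hg : AEStronglyMeasurable g μ) (i : ℕ) :
    ∫ ω, g (Z i ω) ∂P = ∫ z, g z ∂μ := by
  rw [← hZ.map_eq i, integral_map (hZ.aemeasurable i) (by rwa [hZ.map_eq])]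

lemma IsIIDSample.memLp_comp (hZ : IsIIDSample P μ Z) {G : Type*} [NormedAddCommGroup G]
    {g : S → G} {r : ENNReal} (hg : MemLp g r μ) (i : ℕ) : MemLp (fun ω => g (Z i ω)) r P :=
  MemLp.comp_of_map (f := Z i) (by rwa [hZ.map_eq]) (hZ.aemeasurable i)

/-- The strong law of large numbers for sample means. -/
lemma IsIIDSample.tendsto_sampleMean (hZ : IsIIDSample P μ Z) {G : Type*} [NormedAddCommGroup G]
    [NormedSpace ℝ G] [CompleteSpace G] {g : S → G}
    (hg : Integrable g μ) :
    ∀ᵐ ω ∂P, Tendsto (fun n => sampleMean (fun i => Z i ω) n g) atTop (𝓝 (∫ z, g z ∂μ)) := by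
  borelize G
  have h0 : Integrable (fun ω => g (Z 0 ω)) P :=
    memLp_one_iff_integrable.1 (hZ.memLp_comp (memLp_one_iff_integrable.2 hg) 0)
  have hgm : AEMeasurable g μ := hg.aestronglyMeasurable.aemeasurable
  have := strong_law_ae (fun i ω => g (Z i ω)) h0
    (fun i j hij => (hZ.iIndepFun_comp hgm).indepFun hij) (hZ.identDistrib hgm)
  rw [hZ.integral_comp hg.aestronglyMeasurable] at this
  exact this

/-- A law of large numbers which is uniform on a small neighbourhood of `θ₀` in `U`. -/
lemma IsIIDSample.sampleMean_near (hZ : IsIIDSample P μ Z) {Θ G : Type*} [PseudoMetricSpace Θ]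
    [SecondCountableTopology Θ] [NormedAddCommGroup G] [NormedSpace ℝ G] [CompleteSpace G]
    {U : Set Θ} {θ₀ : Θ} (hθ₀ : θ₀ ∈ U)
    {F : Θ → S → G} (hm : ∀ θ ∈ U, AEStronglyMeasurable (F θ) μ)
    (hc : ∀ᵐ z ∂μ, ContinuousOn (fun θ => F θ z) U) {D : S → ℝ} (hD : Integrable D μ)
    (hFD : ∀ᵐ z ∂μ, ∀ θ ∈ U, ‖F θ z‖ ≤ D z) {ε : ℝ} (hε : 0 < ε) :
    ∃ δ > 0, ∀ᵐ ω ∂P, ∀ᶠ n in atTop, ∀ θ ∈ U, dist θ θ₀ < δ →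
      ‖sampleMean (fun i => Z i ω) n (F θ) - ∫ z, F θ₀ z ∂μ‖ ≤ ε := by
  -- `s m` is the oscillation of $F$ around $\theta_0$ on a shrinking ball. It is dominated by $2D$
  -- and tends to $0$ almost everywhere, so its mean falls below $\varepsilon/2$ for some $m$. The
  -- strong law is then needed only for `s m` and `F θ₀`.
  let V : ℕ → Set Θ := fun m => U ∩ Metric.ball θ₀ (1 / ((m : ℝ) + 1))
  let s : ℕ → S → ENNReal := fun m z => ⨆ θ ∈ V m, ‖F θ z - F θ₀ z‖ₑ
  have hsm : ∀ m, AEMeasurable (s m) μ := fun m => by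
    refine aemeasurable_biSup_of_continuousOn
      (fun θ hθ => ((hm θ hθ.1).sub (hm θ₀ hθ₀)).enorm) ?_
    filter_upwards [hc] with z hz
    exact ((hz.mono Set.inter_subset_left).sub continuousOn_const).enorm
  have hsD : ∀ᵐ z ∂μ, ∀ m, s m z ≤ ENNReal.ofReal (2 * D z) := by
    filter_upwards [hFD] with z hz m
    refine iSup₂_le fun θ hθ => ?_
    rw [← ofReal_norm]
    refine ENNReal.ofReal_le_ofReal ((norm_sub_le _ _).trans ?_)
    linarith [hz θ hθ.1, hz θ₀ hθ₀]
  have hFs : ∀ᵐ z ∂μ, ∀ m, ∀ θ ∈ V m, ‖F θ z - F θ₀ z‖ ≤ (s m z).toReal := by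
    filter_upwards [hsD] with z hz m θ hθ
    rw [← ENNReal.ofReal_le_iff_le_toReal (ne_top_of_le_ne_top ENNReal.ofReal_ne_top (hz m)),
      ofReal_norm]
    exact le_biSup (fun θ => ‖F θ z - F θ₀ z‖ₑ) hθ
  have hlim : ∀ᵐ z ∂μ, Tendsto (fun m => (s m z).toReal) atTop (𝓝 0) := by
    filter_upwards [hc] with z hz
    rw [Metric.tendsto_atTop]
    intro η hη
    obtain ⟨δ, hδ, hδF⟩ := Metric.continuousWithinAt_iff.1 (hz θ₀ hθ₀) (η / 2) (half_pos hη)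
    obtain ⟨m₀, hm₀⟩ := exists_nat_one_div_lt hδ
    refine ⟨m₀, fun m hmm => ?_⟩
    have : s m z ≤ ENNReal.ofReal (η / 2) := by
      refine iSup₂_le fun θ hθ => ?_
      rw [← ofReal_norm, ← dist_eq_norm]
      refine ENNReal.ofReal_le_ofReal (hδF hθ.1 (hθ.2.trans ?_)).le
      exact (Nat.one_div_le_one_div hmm).trans_lt hm₀
    have h2 := ENNReal.toReal_le_of_le_ofReal (half_pos hη).le this
    rw [Real.dist_0_eq_abs, abs_of_nonneg ENNReal.toReal_nonneg]
    linarith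
  have hsn : ∀ m, ∀ᵐ z ∂μ, ‖(s m z).toReal‖ ≤ 2 * D z := fun m => by
    filter_upwards [hsD, hFD] with z hz hz'
    rw [Real.norm_of_nonneg ENNReal.toReal_nonneg]
    have := (norm_nonneg _).trans (hz' θ₀ hθ₀)
    exact ENNReal.toReal_le_of_le_ofReal (by positivity) (hz m)
  have hint := tendsto_integral_of_dominated_convergence (fun z => 2 * D z)
    (fun m => (hsm m).ennreal_toReal.aestronglyMeasurable) (hD.const_mul 2) hsn hlim
  rw [integral_zero] at hint
  obtain ⟨m, hmε⟩ := (hint.eventually (gt_mem_nhds (half_pos hε))).exists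
  have hsi : Integrable (fun z => (s m z).toReal) μ :=
    (hD.const_mul 2).mono' (hsm m).ennreal_toReal.aestronglyMeasurable (hsn m)
  have hF0 : Integrable (F θ₀) μ := hD.mono' (hm θ₀ hθ₀) (by
    filter_upwards [hFD] with z hz using hz θ₀ hθ₀)
  refine ⟨1 / ((m : ℝ) + 1), by positivity, ?_⟩
  filter_upwards [hZ.tendsto_sampleMean hsi, hZ.tendsto_sampleMean hF0, hZ.ae hFs]
    with ω h1 h2 h3
  filter_upwards [h1.eventually (gt_mem_nhds hmε),
    h2.eventually (Metric.ball_mem_nhds _ (half_pos hε))] with n hn1 hn2 θ hθ hd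
  have h4 := norm_sampleMean_sub_le (n := n) (z := fun i => Z i ω) (g := F θ) (h := F θ₀)
    (w := fun z => (s m z).toReal) fun i => h3 i m θ ⟨hθ, hd⟩
  rw [dist_eq_norm] at hn2
  calc _ ≤ _ + _ := norm_sub_le_norm_sub_add_norm_sub _ (sampleMean (fun i => Z i ω) n (F θ₀)) _
    _ ≤ ε := by linarith

end LawOfLargeNumbers

/-! ### Differentiation under the integral and second order Taylor expansion. -/

section RegularCriterion

/-- A random criterion `h(θ, z)` which is continuous on `C` and twice continuously differentiable in
the interior of `C`, with values and derivatives up to order two dominated by an integrable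
function `D`. -/
structure IsRegularCriterion {S : Type*} [MeasurableSpace S] {q : ℕ} (μ : Measure S)
    (C : Set (EuclideanSpace ℝ (Fin q))) (h : EuclideanSpace ℝ (Fin q) → S → ℝ) (D : S → ℝ) :
    Prop where
  aestronglyMeasurable : ∀ θ, AEStronglyMeasurable (h θ) μ
  continuousOn : ∀ᵐ z ∂μ, ContinuousOn (fun θ => h θ z) C
  contDiffOn : ∀ᵐ z ∂μ, ContDiffOn ℝ 2 (fun θ => h θ z) (interior C)
  integrable : Integrable D μ
  bound : ∀ᵐ z ∂μ, ∀ θ ∈ C, ‖h θ z‖ ≤ D z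
  bound_fderiv : ∀ᵐ z ∂μ, ∀ θ ∈ interior C, ‖fderiv ℝ (fun θ => h θ z) θ‖ ≤ D z
  bound_fderiv_fderiv : ∀ᵐ z ∂μ, ∀ θ ∈ interior C,
    ‖fderiv ℝ (fderiv ℝ fun θ => h θ z) θ‖ ≤ D z

variable {S : Type*} [MeasurableSpace S] {q : ℕ} {μ : Measure S}
    {C : Set (EuclideanSpace ℝ (Fin q))} {h : EuclideanSpace ℝ (Fin q) → S → ℝ} {D : S → ℝ}

lemma ContDiffOn.differentiableAt_of_isOpen {E F : Type*} [NormedAddCommGroup E]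
    [NormedSpace ℝ E] [NormedAddCommGroup F] [NormedSpace ℝ F] {f : E → F} {U : Set E}
    (hU : IsOpen U) (hf : ContDiffOn ℝ 2 f U) {x : E} (hx : x ∈ U) : DifferentiableAt ℝ f x :=
  (hf.differentiableOn (by norm_num)).differentiableAt (hU.mem_nhds hx)

lemma ContDiffOn.contDiffOn_fderiv_of_isOpen {E F : Type*} [NormedAddCommGroup E]
    [NormedSpace ℝ E] [NormedAddCommGroup F] [NormedSpace ℝ F] {f : E → F} {U : Set E}
    (hU : IsOpen U) (hf : ContDiffOn ℝ 2 f U) : ContDiffOn ℝ 1 (fderiv ℝ f) U :=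
  hf.fderiv_of_isOpen hU (by norm_num)

lemma ContDiffOn.differentiableAt_fderiv_of_isOpen {E F : Type*} [NormedAddCommGroup E]
    [NormedSpace ℝ E] [NormedAddCommGroup F] [NormedSpace ℝ F] {f : E → F} {U : Set E}
    (hU : IsOpen U) (hf : ContDiffOn ℝ 2 f U) {x : E} (hx : x ∈ U) :
    DifferentiableAt ℝ (fderiv ℝ f) x :=
  ((hf.contDiffOn_fderiv_of_isOpen hU).differentiableOn one_ne_zero).differentiableAt
    (hU.mem_nhds hx)

lemma ContDiffOn.continuousOn_fderiv_fderiv_of_isOpen {E F : Type*} [NormedAddCommGroup E]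
    [NormedSpace ℝ E] [NormedAddCommGroup F] [NormedSpace ℝ F] {f : E → F} {U : Set E}
    (hU : IsOpen U) (hf : ContDiffOn ℝ 2 f U) : ContinuousOn (fderiv ℝ (fderiv ℝ f)) U :=
  (hf.contDiffOn_fderiv_of_isOpen hU).continuousOn_fderiv_of_isOpen hU le_rfl

namespace IsRegularCriterion

lemma aestronglyMeasurable_fderiv (hr : IsRegularCriterion μ C h D)
    {θ : EuclideanSpace ℝ (Fin q)} (hθ : θ ∈ interior C) :
    AEStronglyMeasurable (fun z => fderiv ℝ (fun θ => h θ z) θ) μ := by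
  refine aestronglyMeasurable_fderiv_param isOpen_interior hθ
    (fun θ _ => hr.aestronglyMeasurable θ) ?_
  filter_upwards [hr.contDiffOn] with z hz using hz.differentiableAt_of_isOpen isOpen_interior hθ

lemma aestronglyMeasurable_fderiv_fderiv (hr : IsRegularCriterion μ C h D)
    {θ : EuclideanSpace ℝ (Fin q)} (hθ : θ ∈ interior C) :
    AEStronglyMeasurable (fun z => fderiv ℝ (fderiv ℝ fun θ => h θ z) θ) μ := by
  refine aestronglyMeasurable_fderiv_param (F := fun θ z => fderiv ℝ (fun θ => h θ z) θ)
    isOpen_interior hθ (fun θ hθ => hr.aestronglyMeasurable_fderiv hθ) ?_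
  filter_upwards [hr.contDiffOn] with z hz
    using hz.differentiableAt_fderiv_of_isOpen isOpen_interior hθ

lemma integrable_criterion (hr : IsRegularCriterion μ C h D)
    {θ : EuclideanSpace ℝ (Fin q)} (hθ : θ ∈ C) : Integrable (h θ) μ := by
  refine hr.integrable.mono' (hr.aestronglyMeasurable θ) ?_
  filter_upwards [hr.bound] with z hz using hz θ hθ

lemma integrable_fderiv (hr : IsRegularCriterion μ C h D)
    {θ : EuclideanSpace ℝ (Fin q)} (hθ : θ ∈ interior C) :
    Integrable (fun z => fderiv ℝ (fun θ => h θ z) θ) μ := by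
  refine hr.integrable.mono' (hr.aestronglyMeasurable_fderiv hθ) ?_
  filter_upwards [hr.bound_fderiv] with z hz using hz θ hθ

lemma continuousOn_integral (hr : IsRegularCriterion μ C h D) :
    ContinuousOn (fun θ => ∫ z, h θ z ∂μ) C := by
  refine continuousOn_of_dominated (bound := D) (fun θ _ => hr.aestronglyMeasurable θ)
    (fun θ hθ => ?_) hr.integrable hr.continuousOn
  filter_upwards [hr.bound] with z hz using hz θ hθ

lemma hasFDerivAt_integral (hr : IsRegularCriterion μ C h D)
    {θ : EuclideanSpace ℝ (Fin q)} (hθ : θ ∈ interior C) :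
    HasFDerivAt (fun θ => ∫ z, h θ z ∂μ) (∫ z, fderiv ℝ (fun θ => h θ z) θ ∂μ) θ := by
  refine hasFDerivAt_integral_of_dominated_of_fderiv_le (isOpen_interior.mem_nhds hθ)
    (Eventually.of_forall hr.aestronglyMeasurable) (hr.integrable_criterion (interior_subset hθ))
    (hr.aestronglyMeasurable_fderiv hθ) hr.bound_fderiv hr.integrable ?_
  filter_upwards [hr.contDiffOn] with z hz θ hθ
    using (hz.differentiableAt_of_isOpen isOpen_interior hθ).hasFDerivAt

lemma hasFDerivAt_fderiv_integral (hr : IsRegularCriterion μ C h D)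
    {θ : EuclideanSpace ℝ (Fin q)} (hθ : θ ∈ interior C) :
    HasFDerivAt (fderiv ℝ fun θ => ∫ z, h θ z ∂μ)
      (∫ z, fderiv ℝ (fderiv ℝ fun θ => h θ z) θ ∂μ) θ := by
  have h1 : HasFDerivAt (fun θ => ∫ z, fderiv ℝ (fun θ => h θ z) θ ∂μ)
      (∫ z, fderiv ℝ (fderiv ℝ fun θ => h θ z) θ ∂μ) θ := by
    refine hasFDerivAt_integral_of_dominated_of_fderiv_le (isOpen_interior.mem_nhds hθ)
      ?_ (hr.integrable_fderiv hθ) (hr.aestronglyMeasurable_fderiv_fderiv hθ)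
      hr.bound_fderiv_fderiv hr.integrable ?_
    · filter_upwards [isOpen_interior.mem_nhds hθ] with θ hθ
        using hr.aestronglyMeasurable_fderiv hθ
    · filter_upwards [hr.contDiffOn] with z hz θ hθ
        using (hz.differentiableAt_fderiv_of_isOpen isOpen_interior hθ).hasFDerivAt
  refine h1.congr_of_eventuallyEq ?_
  filter_upwards [isOpen_interior.mem_nhds hθ] with θ hθ using (hr.hasFDerivAt_integral hθ).fderiv

end IsRegularCriterion

/-- Second order Taylor expansion at a critical point with symmetric second derivative. -/
lemma isLittleO_taylor_two_of_fderiv_eq_zero {E : Type*} [NormedAddCommGroup E] [NormedSpace ℝ E]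
    {V : E → ℝ} {θ₀ : E} {L : E →L[ℝ] E →L[ℝ] ℝ} (hV : ∀ᶠ θ in 𝓝 θ₀, DifferentiableAt ℝ V θ)
    (hL : HasFDerivAt (fderiv ℝ V) L θ₀) (h0 : fderiv ℝ V θ₀ = 0)
    (hsymm : ∀ u v, L u v = L v u) :
    (fun θ => V θ - V θ₀ - 2⁻¹ * L (θ - θ₀) (θ - θ₀)) =o[𝓝 θ₀] fun θ => ‖θ - θ₀‖ ^ 2 := by
  rw [Asymptotics.isLittleO_iff]
  intro ε hε
  have h1 := hL.isLittleO.def hε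
  rw [h0] at h1
  simp only [sub_zero] at h1
  obtain ⟨r, hr, hball⟩ := Metric.eventually_nhds_iff_ball.1 (hV.and h1)
  filter_upwards [Metric.ball_mem_nhds θ₀ hr] with θ hθ
  have hsub : Metric.closedBall θ₀ ‖θ - θ₀‖ ⊆ Metric.ball θ₀ r :=
    Metric.closedBall_subset_ball (by rwa [← dist_eq_norm])
  -- The mean value inequality is applied to $V$ minus its quadratic part, whose derivative is at
  -- most $\varepsilon|\theta-\theta_0|$ on this ball.
  have hg : ∀ x ∈ Metric.closedBall θ₀ ‖θ - θ₀‖,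
      HasFDerivWithinAt (fun θ => V θ - 2⁻¹ * L (θ - θ₀) (θ - θ₀))
        (fderiv ℝ V x - L (x - θ₀)) (Metric.closedBall θ₀ ‖θ - θ₀‖) x := by
    intro x hx
    have hs : HasFDerivAt (fun θ => θ - θ₀) (ContinuousLinearMap.id ℝ E) x :=
      (hasFDerivAt_id x).sub_const θ₀
    have h2 := ((L.hasFDerivAt.comp x hs).clm_apply hs).const_mul (2⁻¹ : ℝ)
    refine (((hball x (hsub hx)).1.hasFDerivAt.sub h2).congr_fderiv ?_).hasFDerivWithinAt
    ext v
    simp only [sub_apply, smul_apply,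
      add_apply, ContinuousLinearMap.comp_apply,
      ContinuousLinearMap.flip_apply, ContinuousLinearMap.id_apply, Function.comp, smul_eq_mul]
    rw [hsymm v (x - θ₀)]
    ring
  have h3 := (convex_closedBall θ₀ ‖θ - θ₀‖).norm_image_sub_le_of_norm_hasFDerivWithin_le
    (C := ε * ‖θ - θ₀‖) hg (fun x hx => by
      refine (hball x (hsub hx)).2.trans ?_
      rw [mem_closedBall_iff_norm] at hx
      gcongr) (Metric.mem_closedBall_self (norm_nonneg _)) (y := θ)
      (by rw [mem_closedBall_iff_norm])
  simp only [sub_self, map_zero, mul_zero, sub_zero] at h3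
  rw [norm_pow, norm_norm, sq, ← mul_assoc]
  refine le_trans (le_of_eq ?_) h3
  congr 1
  ring

end RegularCriterion

/-! ### Consistency and linearized first order condition for M-estimators. -/

section MEstimation

lemma hasFDerivAt_sampleMean {E S G : Type*} [NormedAddCommGroup E] [NormedSpace ℝ E]
    [NormedAddCommGroup G] [NormedSpace ℝ G] {F : E → S → G} {z : ℕ → S} (n : ℕ) {θ : E}
    (hd : ∀ i, DifferentiableAt ℝ (fun θ => F θ (z i)) θ) :
    HasFDerivAt (fun θ => sampleMean z n (F θ))
      (sampleMean z n fun s => fderiv ℝ (fun θ => F θ s) θ) θ :=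
  (HasFDerivAt.fun_sum fun i _ => (hd i).hasFDerivAt).fun_const_smul _

variable {Ω S : Type*} [MeasurableSpace Ω] [MeasurableSpace S] {P : Measure Ω}
  {q : ℕ} {μ : Measure S} {C : Set (EuclideanSpace ℝ (Fin q))}
  {h : EuclideanSpace ℝ (Fin q) → S → ℝ} {D : S → ℝ} {Z : ℕ → Ω → S}
  {θ₀ : EuclideanSpace ℝ (Fin q)} {θhat : ℕ → Ω → EuclideanSpace ℝ (Fin q)}

/-- Almost sure consistency of minimizers of the empirical criterion. -/
lemma IsRegularCriterion.tendsto_minimizer (hr : IsRegularCriterion μ C h D)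
    (hZ : IsIIDSample P μ Z) (hC : IsCompact C) (hθ₀ : θ₀ ∈ C)
    (hmin : ∀ θ ∈ C, θ ≠ θ₀ → ∫ z, h θ₀ z ∂μ < ∫ z, h θ z ∂μ)
    (hθhat : ∀ᵐ ω ∂P, ∀ᶠ N in atTop, θhat N ω ∈ C ∧
      IsMinOn (fun θ => sampleMean (fun i => Z i ω) N (h θ)) C (θhat N ω)) :
    ∀ᵐ ω ∂P, Tendsto (fun N => θhat N ω) atTop (𝓝 θ₀) := by
  have key : ∀ r : ℝ, 0 < r → ∀ᵐ ω ∂P, ∀ᶠ N in atTop, θhat N ω ∉ C \ Metric.ball θ₀ r := by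
    intro r hr0
    -- Compactness reduces the claim to one neighbourhood of each $\theta\ne\theta_0$ which the
    -- minimizers eventually avoid.
    refine (hC.diff Metric.isOpen_ball).induction_on
      (p := fun s => ∀ᵐ ω ∂P, ∀ᶠ N in atTop, θhat N ω ∉ s) (by simp) ?_ ?_ ?_
    · intro s t hst ht
      filter_upwards [ht] with ω hω
      filter_upwards [hω] with N hN using fun h => hN (hst h)
    · intro s t hs ht
      filter_upwards [hs, ht] with ω hω hω'
      filter_upwards [hω, hω'] with N hN hN' using fun h => h.elim hN hN'
    · rintro θ ⟨hθC, hθr⟩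
      have hne : θ ≠ θ₀ := by rintro rfl; exact hθr (Metric.mem_ball_self hr0)
      -- With a third of the gap, errors of $\varepsilon$ near $\theta$ and at $\theta_0$ still
      -- leave the empirical criterion larger near $\theta$ than at $\theta_0$.
      set ε := (∫ z, h θ z ∂μ - ∫ z, h θ₀ z ∂μ) / 3 with hε
      have hε0 : 0 < ε := by have := hmin θ hθC hne; rw [hε]; linarith
      obtain ⟨δ, hδ, hnear⟩ := hZ.sampleMean_near hθC (fun θ _ => hr.aestronglyMeasurable θ)
        hr.continuousOn hr.integrable hr.bound hε0
      refine ⟨(C \ Metric.ball θ₀ r) ∩ Metric.ball θ δ,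
        inter_mem_nhdsWithin _ (Metric.ball_mem_nhds _ hδ), ?_⟩
      filter_upwards [hnear, hθhat, hZ.tendsto_sampleMean (hr.integrable_criterion hθ₀)]
        with ω h1 h2 h3
      filter_upwards [h1, h2, h3.eventually (Metric.ball_mem_nhds _ hε0)] with N h4 h5 h6 h7
      have h8 := abs_le.1 (h4 _ h5.1 h7.2)
      have h9 := isMinOn_iff.1 h5.2 θ₀ hθ₀
      rw [Real.dist_eq] at h6
      have h10 := abs_lt.1 h6
      linarith [h8.1, h10.2]
  have hkey := ae_all_iff.2 fun n : ℕ => key (1 / ((n : ℝ) + 1)) (by positivity)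
  filter_upwards [hkey, hθhat] with ω hω h2
  rw [Metric.tendsto_nhds]
  intro ε hε
  obtain ⟨n, hn⟩ := exists_nat_one_div_lt hε
  filter_upwards [hω n, h2] with N hN h3
  by_contra hlt
  exact hN ⟨h3.1, fun hb => hlt ((Metric.mem_ball.1 hb).trans hn)⟩

/-- The first order condition for minimizers of the empirical criterion, linearized at `θ₀`. -/
lemma IsRegularCriterion.isLittleO_first_order (hr : IsRegularCriterion μ C h D)
    (hZ : IsIIDSample P μ Z) (hθ₀ : θ₀ ∈ interior C)
    (hθhat : ∀ᵐ ω ∂P, ∀ᶠ N in atTop,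
      IsMinOn (fun θ => sampleMean (fun i => Z i ω) N (h θ)) C (θhat N ω))
    (hlim : ∀ᵐ ω ∂P, Tendsto (fun N => θhat N ω) atTop (𝓝 θ₀)) :
    ∀ᵐ ω ∂P, (fun N => (∫ z, fderiv ℝ (fderiv ℝ fun θ => h θ z) θ₀ ∂μ) (θhat N ω - θ₀) +
      sampleMean (fun i => Z i ω) N fun z => fderiv ℝ (fun θ => h θ z) θ₀) =o[atTop]
      fun N => θhat N ω - θ₀ := by
  set L := ∫ z, fderiv ℝ (fderiv ℝ fun θ => h θ z) θ₀ ∂μ with hL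
  have hcont : ∀ᵐ z ∂μ, ContinuousOn (fderiv ℝ (fderiv ℝ fun θ => h θ z)) (interior C) := by
    filter_upwards [hr.contDiffOn] with z hz
      using hz.continuousOn_fderiv_fderiv_of_isOpen isOpen_interior
  have hnear := fun n : ℕ => hZ.sampleMean_near hθ₀
    (F := fun θ z => fderiv ℝ (fderiv ℝ fun θ => h θ z) θ)
    (fun θ hθ => hr.aestronglyMeasurable_fderiv_fderiv hθ)
    hcont hr.integrable hr.bound_fderiv_fderiv (ε := 1 / ((n : ℝ) + 1)) (by positivity)
  choose δ hδ hnear using hnear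
  filter_upwards [ae_all_iff.2 hnear, hθhat, hlim, hZ.ae hr.contDiffOn] with ω h1 h2 h3 h4
  rw [Asymptotics.isLittleO_iff]
  intro ε hε
  obtain ⟨n, hn⟩ := exists_nat_one_div_lt hε
  obtain ⟨r, hr0, hrC⟩ := Metric.isOpen_iff.1 isOpen_interior θ₀ hθ₀
  filter_upwards [h1 n, h2, h3.eventually (Metric.ball_mem_nhds _ (lt_min (hδ n) hr0))]
    with N h5 h6 h7
  have hd1 := fun θ (hθ : θ ∈ interior C) => hasFDerivAt_sampleMean (F := h) N
    fun i => (h4 i).differentiableAt_of_isOpen isOpen_interior hθ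
  have hd2 := fun θ (hθ : θ ∈ interior C) =>
    hasFDerivAt_sampleMean (F := fun θ z => fderiv ℝ (fun θ => h θ z) θ) N
    fun i => (h4 i).differentiableAt_fderiv_of_isOpen isOpen_interior hθ
  have hmem : θhat N ω ∈ interior C := hrC (Metric.ball_subset_ball (min_le_right _ _) h7)
  have hzero := (h6.isLocalMin (mem_interior_iff_mem_nhds.1 hmem)).hasFDerivAt_eq_zero
    (hd1 _ hmem)
  have hsub : Metric.ball θ₀ (min (δ n) r) ⊆ interior C :=
    (Metric.ball_subset_ball (min_le_right _ _)).trans hrC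
  -- On this ball the empirical Hessian is within $1/(n+1)<\varepsilon$ of $L$, so the empirical
  -- gradient is nearly affine with slope $L$; it vanishes at the minimizer.
  have hmv := (convex_ball θ₀ (min (δ n) r)).norm_image_sub_le_of_norm_hasFDerivWithin_le'
    (fun θ hθ => (hd2 θ (hsub hθ)).hasFDerivWithinAt)
    (fun θ hθ => h5 θ (hsub hθ) (lt_of_lt_of_le hθ (min_le_left _ _)))
    (Metric.mem_ball_self (lt_min (hδ n) hr0)) h7
  rw [hzero, zero_sub, ← neg_add', norm_neg] at hmv
  rw [add_comm]
  exact hmv.trans (by gcongr)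

end MEstimation

/-! ### Quadratic forms, outer products and inverse Hessians. -/

section MatrixLemmas

lemma EuclideanSpace.real_inner_eq_dotProduct {q : ℕ} (x y : EuclideanSpace ℝ (Fin q)) :
    inner ℝ x y = x.ofLp ⬝ᵥ y.ofLp := by
  rw [EuclideanSpace.inner_eq_star_dotProduct, star_trivial, dotProduct_comm]

/-- Expanding $\langle v,t\rangle^2$ in coordinates and integrating gives $t^TMt$, which is thus
nonnegative. The same identity supplies the covariance hypothesis of the central limit theorem. -/
lemma posSemidef_integral_outer {α : Type*} [MeasurableSpace α] {μ : Measure α} {q : ℕ}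
    {v : α → EuclideanSpace ℝ (Fin q)} (hv : ∀ i j, Integrable (fun a => v a i * v a j) μ)
    {M : Matrix (Fin q) (Fin q) ℝ} (hM : ∀ i j, M i j = ∫ a, v a i * v a j ∂μ) :
    M.PosSemidef ∧ ∀ t : EuclideanSpace ℝ (Fin q),
      ∫ a, inner ℝ (v a) t ^ 2 ∂μ = t.ofLp ⬝ᵥ M *ᵥ t.ofLp := by
  have h2 : ∀ t : EuclideanSpace ℝ (Fin q),
      ∫ a, inner ℝ (v a) t ^ 2 ∂μ = t.ofLp ⬝ᵥ M *ᵥ t.ofLp := by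
    intro t
    have h1 : ∀ a, inner ℝ (v a) t ^ 2 = ∑ i, ∑ j, t i * t j * (v a i * v a j) := by
      intro a
      rw [EuclideanSpace.real_inner_eq_dotProduct, sq, dotProduct, Finset.sum_mul_sum]
      refine Finset.sum_congr rfl fun i _ => Finset.sum_congr rfl fun j _ => by ring
    simp_rw [h1]
    rw [integral_finsetSum _ fun i _ => integrable_finsetSum _ fun j _ => (hv i j).const_mul _]
    simp only [dotProduct, Matrix.mulVec, Finset.mul_sum]
    refine Finset.sum_congr rfl fun i _ => ?_
    rw [integral_finsetSum _ fun j _ => (hv i j).const_mul _]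
    refine Finset.sum_congr rfl fun j _ => ?_
    rw [integral_const_mul, hM]
    ring
  refine ⟨Matrix.PosSemidef.of_dotProduct_mulVec_nonneg ?_ fun x => ?_, h2⟩
  · ext i j
    simp only [Matrix.conjTranspose_apply, star_trivial, hM]
    simp_rw [mul_comm]
  · rw [star_trivial]
    have := h2 (WithLp.toLp 2 x)
    simp only at this
    rw [← this]
    exact integral_nonneg fun a => sq_nonneg _

lemma ContinuousLinearMap.apply_apply_eq_dotProduct {q : ℕ}
    (L : EuclideanSpace ℝ (Fin q) →L[ℝ] EuclideanSpace ℝ (Fin q) →L[ℝ] ℝ)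
    {H : Matrix (Fin q) (Fin q) ℝ}
    (hH : ∀ i j, H i j = L (EuclideanSpace.single i 1) (EuclideanSpace.single j 1))
    (u v : EuclideanSpace ℝ (Fin q)) : L u v = u.ofLp ⬝ᵥ H *ᵥ v.ofLp := by
  conv_lhs => rw [← (EuclideanSpace.basisFun (Fin q) ℝ).sum_repr u,
    ← (EuclideanSpace.basisFun (Fin q) ℝ).sum_repr v]
  simp only [map_sum, map_smul, EuclideanSpace.basisFun_apply, EuclideanSpace.basisFun_repr,
    sum_apply, smul_apply, smul_eq_mul, dotProduct,
    Matrix.mulVec, Finset.mul_sum, ← hH]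
  rw [Finset.sum_comm]
  refine Finset.sum_congr rfl fun i _ => Finset.sum_congr rfl fun j _ => by ring

/-- The vector representing the functional $L\,u$ is $Hu$. This turns the first order relation
between functionals into one between vectors, solved for the error. -/
lemma Matrix.toEuclideanCLM_inv_toDual_symm {q : ℕ}
    (L : EuclideanSpace ℝ (Fin q) →L[ℝ] EuclideanSpace ℝ (Fin q) →L[ℝ] ℝ)
    {H : Matrix (Fin q) (Fin q) ℝ}
    (hH : ∀ u v, L u v = u.ofLp ⬝ᵥ H *ᵥ v.ofLp) (hpos : H.PosDef)
    (u : EuclideanSpace ℝ (Fin q)) :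
    Matrix.toEuclideanCLM (𝕜 := ℝ) H⁻¹ ((InnerProductSpace.toDual ℝ _).symm (L u)) = u := by
  have h1 : ((InnerProductSpace.toDual ℝ _).symm (L u)).ofLp = H *ᵥ u.ofLp := by
    refine dotProduct_eq _ _ fun v => ?_
    have h2 := InnerProductSpace.toDual_symm_apply (𝕜 := ℝ) (x := WithLp.toLp 2 v) (y := L u)
    rw [EuclideanSpace.real_inner_eq_dotProduct, hH] at h2
    have hsymm : Hᵀ = H := by simpa using hpos.isHermitian.eq
    rw [h2, Matrix.dotProduct_mulVec, ← Matrix.mulVec_transpose, hsymm]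
  ext1
  rw [Matrix.ofLp_toEuclideanCLM, h1, Matrix.mulVec_mulVec,
    Matrix.nonsing_inv_mul _ ((Matrix.isUnit_iff_isUnit_det _).1 hpos.isUnit), Matrix.one_mulVec]

lemma Matrix.PosDef.inner_toEuclideanCLM_inv {q : ℕ} {H : Matrix (Fin q) (Fin q) ℝ}
    (hpos : H.PosDef) (x y : EuclideanSpace ℝ (Fin q)) :
    inner ℝ (Matrix.toEuclideanCLM (𝕜 := ℝ) H⁻¹ x) y =
      inner ℝ x (Matrix.toEuclideanCLM (𝕜 := ℝ) H⁻¹ y) := by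
  have hsymm : (H⁻¹)ᵀ = H⁻¹ := by simpa using hpos.inv.isHermitian.eq
  rw [EuclideanSpace.real_inner_eq_dotProduct, EuclideanSpace.real_inner_eq_dotProduct,
    Matrix.ofLp_toEuclideanCLM, Matrix.ofLp_toEuclideanCLM, Matrix.dotProduct_mulVec,
    ← Matrix.mulVec_transpose, hsymm]

end MatrixLemmas

/-! ### Asymptotic normality of M-estimators and of the excess criterion. -/

section AsymptoticNormality

lemma MeasureTheory.TendstoInDistribution.of_map_eq {ι E Ω Ω₁ Ω₂ : Type*} [MeasurableSpace Ω]
    [MeasurableSpace Ω₁] [MeasurableSpace Ω₂] {P : Measure Ω} {P₁ : Measure Ω₁} {P₂ : Measure Ω₂}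
    [IsProbabilityMeasure P] [IsProbabilityMeasure P₁] [IsProbabilityMeasure P₂]
    [TopologicalSpace E] [MeasurableSpace E] [OpensMeasurableSpace E] {X : ι → Ω → E}
    {l : Filter ι} {U : Ω₁ → E} {V : Ω₂ → E}
    (h : TendstoInDistribution X l U (fun _ => P) P₁) (hV : AEMeasurable V P₂)
    (heq : P₁.map U = P₂.map V) : TendstoInDistribution X l V (fun _ => P) P₂ :=
  ⟨h.forall_aemeasurable, hV, by
    have : (⟨P₂.map V, Measure.isProbabilityMeasure_map hV⟩ : ProbabilityMeasure E) =
        ⟨P₁.map U, Measure.isProbabilityMeasure_map h.aemeasurable_limit⟩ :=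
      Subtype.ext heq.symm
    rw [this]
    exact h.tendsto⟩

variable {Ω S : Type*} [MeasurableSpace Ω] [MeasurableSpace S] {P : Measure Ω}
  [IsProbabilityMeasure P]
  {q : ℕ} {μ : Measure S} {C : Set (EuclideanSpace ℝ (Fin q))}
  {h : EuclideanSpace ℝ (Fin q) → S → ℝ} {D : S → ℝ} {Z : ℕ → Ω → S}
  {θ₀ : EuclideanSpace ℝ (Fin q)} {θhat : ℕ → Ω → EuclideanSpace ℝ (Fin q)}

/-- Fermat's rule at an interior minimum; it centers the summands of the central limit theorem. -/
lemma IsRegularCriterion.fderiv_integral_eq_zero (hr : IsRegularCriterion μ C h D)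
    (hθ₀ : θ₀ ∈ interior C)
    (hmin : ∀ θ ∈ C, θ ≠ θ₀ → ∫ z, h θ₀ z ∂μ < ∫ z, h θ z ∂μ) :
    ∫ z, fderiv ℝ (fun θ => h θ z) θ₀ ∂μ = 0 := by
  have hm : IsMinOn (fun θ => ∫ z, h θ z ∂μ) C θ₀ := isMinOn_iff.2 fun θ hθ => by
    by_cases hne : θ = θ₀
    · rw [hne]
    · exact (hmin θ hθ hne).le
  exact (hm.isLocalMin (mem_interior_iff_mem_nhds.1 hθ₀)).hasFDerivAt_eq_zero
    (hr.hasFDerivAt_integral hθ₀)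

/-- Asymptotic normality of minimizers of the empirical criterion. -/
theorem IsRegularCriterion.tendstoInDistribution_minimizer (hr : IsRegularCriterion μ C h D)
    (hZ : IsIIDSample P μ Z) (hC : IsCompact C) (hθ₀ : θ₀ ∈ interior C)
    (hmin : ∀ θ ∈ C, θ ≠ θ₀ → ∫ z, h θ₀ z ∂μ < ∫ z, h θ z ∂μ)
    (hL2 : MemLp (fun z => fderiv ℝ (fun θ => h θ z) θ₀) 2 μ)
    {H Q : Matrix (Fin q) (Fin q) ℝ}
    (hH : H = hessianMatrix (fun θ => ∫ z, h θ z ∂μ) θ₀) (hpos : H.PosDef)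
    (hQ : ∀ i j, Q i j =
      ∫ z, gradient (fun θ => h θ z) θ₀ i * gradient (fun θ => h θ z) θ₀ j ∂μ)
    (hmeas : ∀ N, 1 ≤ N → AEMeasurable (θhat N) P)
    (hθhat : ∀ N, 1 ≤ N → ∀ᵐ ω ∂P, θhat N ω ∈ C ∧
      IsMinOn (fun θ => sampleMean (fun i => Z i ω) N (h θ)) C (θhat N ω)) :
    TendstoInDistribution (fun (N : ℕ) ω => √(N : ℝ) • (θhat N ω - θ₀)) atTop
      (fun g : EuclideanSpace ℝ (Fin q) => g) (fun _ => P)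
      (multivariateGaussian 0 (H⁻¹ * Q * H⁻¹)) ∧
    TendstoInDistribution
      (fun (N : ℕ) ω => (N : ℝ) * (∫ z, h (θhat N ω) z ∂μ - ∫ z, h θ₀ z ∂μ)) atTop
      (fun g : EuclideanSpace ℝ (Fin q) => 2⁻¹ * (g.ofLp ⬝ᵥ (H *ᵥ g.ofLp))) (fun _ => P)
      (multivariateGaussian 0 (H⁻¹ * Q * H⁻¹)) := by
  have hev : ∀ᵐ ω ∂P, ∀ᶠ N in atTop, θhat N ω ∈ C ∧
      IsMinOn (fun θ => sampleMean (fun i => Z i ω) N (h θ)) C (θhat N ω) := by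
    have h0 : ∀ᵐ ω ∂P, ∀ N, 1 ≤ N → θhat N ω ∈ C ∧
        IsMinOn (fun θ => sampleMean (fun i => Z i ω) N (h θ)) C (θhat N ω) :=
      ae_all_iff.2 fun N => by
        by_cases hN : 1 ≤ N
        · filter_upwards [hθhat N hN] with ω hω _ using hω
        · exact Eventually.of_forall fun ω h1 => absurd h1 hN
    filter_upwards [h0] with ω hω
    exact eventually_atTop.2 ⟨1, hω⟩
  have hlim := hr.tendsto_minimizer hZ hC (interior_subset hθ₀) hmin hev
  have hfirst := hr.isLittleO_first_order hZ hθ₀ (hev.mono fun ω hω => hω.mono fun N hN => hN.2) hlim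
  set V : EuclideanSpace ℝ (Fin q) → ℝ := fun θ => ∫ z, h θ z ∂μ with hV
  set L := ∫ z, fderiv ℝ (fderiv ℝ fun θ => h θ z) θ₀ ∂μ with hL
  have hLH : ∀ u v, L u v = u.ofLp ⬝ᵥ H *ᵥ v.ofLp := by
    refine L.apply_apply_eq_dotProduct fun i j => ?_
    rw [hH, hessianMatrix, Matrix.of_apply, iteratedFDeriv_two_apply,
      (hr.hasFDerivAt_fderiv_integral hθ₀).fderiv]
    rfl
  set A := Matrix.toEuclideanCLM (𝕜 := ℝ) H⁻¹ with hA
  set grad : S → EuclideanSpace ℝ (Fin q) := fun z => gradient (fun θ => h θ z) θ₀ with hgrad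
  have hgradL2 : MemLp grad 2 μ :=
    (InnerProductSpace.toDual ℝ (EuclideanSpace ℝ (Fin q))).symm.toContinuousLinearEquiv
      |>.toContinuousLinearMap.comp_memLp' hL2
  -- The influence function $-H^{-1}\nabla h(\theta_0,\cdot)$, with covariance $H^{-1}QH^{-1}$.
  let ξ : S → EuclideanSpace ℝ (Fin q) := fun z => -A (grad z)
  have hξL2 : MemLp ξ 2 μ := (A.comp_memLp' hgradL2).neg
  have hgi : ∀ i, MemLp (fun z => grad z i) 2 μ := fun i =>
    (EuclideanSpace.proj (𝕜 := ℝ) i).comp_memLp' hgradL2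
  obtain ⟨hQpos, hQq⟩ := posSemidef_integral_outer (v := grad)
    (fun i j => (hgi i).integrable_mul (hgi j)) hQ
  have hsymm : (H⁻¹)ᵀ = H⁻¹ := by simpa using hpos.inv.isHermitian.eq
  have hSpos : (H⁻¹ * Q * H⁻¹).PosSemidef := by
    have := hQpos.mul_mul_conjTranspose_same H⁻¹
    rwa [hpos.inv.isHermitian.eq] at this
  have hgradmean : ∫ z, grad z ∂μ = 0 := by
    have h1 := ((InnerProductSpace.toDual ℝ (EuclideanSpace ℝ (Fin q))).symm.toContinuousLinearEquiv
      |>.toContinuousLinearMap).integral_comp_comm (hr.integrable_fderiv hθ₀)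
    rw [hr.fderiv_integral_eq_zero hθ₀ hmin, map_zero] at h1
    exact h1
  have hP : IsProbabilityMeasure μ := by
    rw [← hZ.map_eq 0]; exact Measure.isProbabilityMeasure_map (hZ.aemeasurable 0)
  have hξmean : ∫ z, ξ z ∂μ = 0 := by
    simp only [ξ]
    rw [integral_neg, A.integral_comp_comm (hgradL2.integrable (by norm_num)), hgradmean, map_zero,
      neg_zero]
  have hξm : AEMeasurable ξ μ := hξL2.aestronglyMeasurable.aemeasurable
  have hclt := tendstoInDistribution_multivariateGaussian (hZ.iIndepFun_comp hξm)
    (hZ.identDistrib hξm) (hZ.memLp_comp hξL2 0)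
    (by rw [hZ.integral_comp hξL2.aestronglyMeasurable, hξmean]) hSpos (fun t => by
      rw [hZ.integral_comp (g := fun z => inner ℝ (ξ z) t ^ 2)
        ((hξL2.aestronglyMeasurable.inner_const).pow 2)]
      simp only [ξ, inner_neg_left, neg_sq, hA, hpos.inner_toEuclideanCLM_inv]
      rw [hQq, Matrix.ofLp_toEuclideanCLM, ← Matrix.mulVec_mulVec, ← Matrix.mulVec_mulVec,
        Matrix.dotProduct_mulVec _ H⁻¹, ← Matrix.mulVec_transpose, hsymm])
  have hmeas' : ∀ N : ℕ, AEMeasurable (fun ω => √(N : ℝ) • (θhat N ω - θ₀)) P := fun N => by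
    rcases Nat.eq_zero_or_pos N with rfl | hN
    · simp
    · exact ((hmeas N hN).sub_const θ₀).const_smul (√(N : ℝ))
  have hdist : TendstoInDistribution (fun (N : ℕ) ω => √(N : ℝ) • (θhat N ω - θ₀)) atTop
      (fun g : EuclideanSpace ℝ (Fin q) => g) (fun _ => P)
      (multivariateGaussian 0 (H⁻¹ * Q * H⁻¹)) := by
    refine hclt.of_isLittleO_sub hmeas' ?_
    filter_upwards [hfirst] with ω hω
    have h1 : (fun N => sampleMean (fun i => Z i ω) N ξ - (θhat N ω - θ₀)) =o[atTop]
        fun N => θhat N ω - θ₀ := by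
      have h2 := ((A.comp (InnerProductSpace.toDual ℝ
        (EuclideanSpace ℝ (Fin q))).symm.toContinuousLinearEquiv.toContinuousLinearMap).isBigO_comp
        _ atTop).trans_isLittleO hω
      refine h2.neg_left.congr_left fun N => ?_
      have h3 := Matrix.toEuclideanCLM_inv_toDual_symm L hLH hpos (θhat N ω - θ₀)
      simp only [ContinuousLinearMap.comp_apply, ContinuousLinearEquiv.coe_coe,
        LinearIsometryEquiv.coe_toContinuousLinearEquiv, map_add, hA, h3, sampleMean,
        map_smul, map_sum, ξ, Finset.sum_neg_distrib, smul_neg, hgrad, gradient]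
      abel
    -- Asymptotic equivalence is symmetric, so the remainder is also negligible against the sample
    -- mean of `ξ`, whose rescaling is known to converge in law.
    have h4 : Asymptotics.IsEquivalent atTop (fun N => sampleMean (fun i => Z i ω) N ξ)
      fun N => θhat N ω - θ₀ := h1
    have h5 := (Asymptotics.isBigO_refl (fun N : ℕ => √(N : ℝ)) atTop).smul_isLittleO
      h4.symm.isLittleO
    refine h5.congr (fun N => ?_) fun N => ?_
    · simp only [Pi.sub_apply, smul_sub, sampleMean]
      rw [smul_smul √(N : ℝ) (N : ℝ)⁻¹, ← div_eq_mul_inv, Real.sqrt_div_self]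
    · rw [sampleMean, smul_smul, ← div_eq_mul_inv, Real.sqrt_div_self]
  refine ⟨hdist, ?_⟩
  have hVmeas : ∀ N : ℕ, AEMeasurable (fun ω => (N : ℝ) * (V (θhat N ω) - V θ₀)) P := fun N => by
    rcases Nat.eq_zero_or_pos N with rfl | hN
    · simp
    · classical
      -- $V$ is known to be continuous only on $C$; extending it by zero is harmless because the
      -- estimator almost surely lies in $C$.
      have hp : Measurable (C.piecewise V 0) :=
        hr.continuousOn_integral.measurable_piecewise continuousOn_const hC.measurableSet
      have h1 : AEMeasurable (fun ω => V (θhat N ω)) P := by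
        refine (hp.comp_aemeasurable (hmeas N hN)).congr ?_
        filter_upwards [hθhat N hN] with ω hω
        simp [hω.1]
      exact (h1.sub_const _).const_mul _
  have hq : Continuous fun g : EuclideanSpace ℝ (Fin q) => 2⁻¹ * L g g := by fun_prop
  have hquad : TendstoInDistribution
      (fun (N : ℕ) ω => 2⁻¹ * L (√(N : ℝ) • (θhat N ω - θ₀)) (√(N : ℝ) • (θhat N ω - θ₀))) atTop
      (fun g : EuclideanSpace ℝ (Fin q) => 2⁻¹ * (g.ofLp ⬝ᵥ (H *ᵥ g.ofLp))) (fun _ => P)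
      (multivariateGaussian 0 (H⁻¹ * Q * H⁻¹)) := by
    have := hdist.continuous_comp hq
    simp only [Function.comp_def] at this
    simpa only [hLH] using this
  have hnorm : TendstoInDistribution
      (fun (N : ℕ) ω => ‖√(N : ℝ) • (θhat N ω - θ₀)‖ ^ 2) atTop
      (fun g : EuclideanSpace ℝ (Fin q) => ‖g‖ ^ 2) (fun _ => P)
      (multivariateGaussian 0 (H⁻¹ * Q * H⁻¹)) :=
    hdist.continuous_comp (g := fun g => ‖g‖ ^ 2) (by fun_prop)
  -- Times $N$, the Taylor remainder is $o(|\sqrt N(\hat\theta_N-\theta_0)|^2)$ almost surely, and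
  -- that square converges in law.
  refine tendstoInDistribution_of_tendstoInMeasure_sub _ _ hquad
    (tendstoInMeasure_zero_of_isLittleO hnorm
      (fun N => (hVmeas N).sub (hq.measurable.comp_aemeasurable (hmeas' N))) ?_) hVmeas
  have htaylor := isLittleO_taylor_two_of_fderiv_eq_zero (V := V) (θ₀ := θ₀) (L := L)
    (by filter_upwards [isOpen_interior.mem_nhds hθ₀] with θ hθ
          using (hr.hasFDerivAt_integral hθ).differentiableAt)
    (hr.hasFDerivAt_fderiv_integral hθ₀)
    (by rw [(hr.hasFDerivAt_integral hθ₀).fderiv, hr.fderiv_integral_eq_zero hθ₀ hmin])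
    (fun u v => by
      have : Hᵀ = H := by simpa using hpos.isHermitian.eq
      rw [hLH, hLH, Matrix.dotProduct_mulVec, ← Matrix.mulVec_transpose, this, dotProduct_comm])
  filter_upwards [hlim] with ω hω
  have h5 := (Asymptotics.isBigO_refl (fun N : ℕ => (N : ℝ)) atTop).mul_isLittleO
    (htaylor.comp_tendsto hω)
  refine h5.congr (fun N => ?_) fun N => ?_
  · simp only [Function.comp_apply, map_smul, smul_apply, smul_eq_mul, Pi.sub_apply]
    have := Real.mul_self_sqrt (Nat.cast_nonneg (α := ℝ) N)
    linear_combination (2⁻¹ * L (θhat N ω - θ₀) (θhat N ω - θ₀)) * this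
  · simp only [Function.comp_apply, norm_smul, mul_pow, Real.norm_eq_abs, sq_abs,
      Real.sq_sqrt (Nat.cast_nonneg (α := ℝ) N)]

end AsymptoticNormality

/-! ### Conditionally iid draws and the bias-variance identity. -/

section IIDPower

variable {α β : Type*} [MeasurableSpace α] [MeasurableSpace β]

/-- The kernel `x ↦ κ(x)^{⊗ K}` of `K` independent draws from `κ(x)`. -/
noncomputable def ProbabilityTheory.Kernel.iidPower (κ : Kernel α β) [IsMarkovKernel κ] (K : ℕ) :
    Kernel α (Fin K → β) where
  toFun x := Measure.pi fun _ => κ x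
  measurable' := by
    refine Measurable.measure_of_isPiSystem_of_isProbabilityMeasure generateFrom_pi.symm
      isPiSystem_pi ?_
    rintro _ ⟨t, ht, rfl⟩
    simp only [Measure.pi_pi]
    exact Finset.measurable_fun_prod _ fun k _ => κ.measurable_coe (ht k (Set.mem_univ k))

lemma ProbabilityTheory.Kernel.iidPower_apply (κ : Kernel α β) [IsMarkovKernel κ] (K : ℕ) (x : α) :
    κ.iidPower K x = Measure.pi fun _ => κ x := rfl

instance (κ : Kernel α β) [IsMarkovKernel κ] (K : ℕ) : IsMarkovKernel (κ.iidPower K) :=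
  ⟨fun x => by rw [Kernel.iidPower_apply]; infer_instance⟩

/-- Measurable rectangles form a generating π-system, so their probabilities determine the law of a
block. -/
lemma MeasureTheory.Measure.eq_compProd_iidPower {ν : Measure α} [IsProbabilityMeasure ν]
    {κ : Kernel α β} [IsMarkovKernel κ] {K : ℕ} {m : Measure (α × (Fin K → β))}
    [IsProbabilityMeasure m]
    (h : ∀ (s : Set α) (t : Fin K → Set β), MeasurableSet s → (∀ k, MeasurableSet (t k)) →
      m (s ×ˢ Set.univ.pi t) = ∫⁻ x in s, ∏ k, κ x (t k) ∂ν) :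
    m = ν ⊗ₘ κ.iidPower K := by
  refine ext_of_generate_finite _
    (generateFrom_eq_prod MeasurableSpace.generateFrom_measurableSet generateFrom_pi
      isCountablySpanning_measurableSet ?_).symm
    (MeasurableSpace.isPiSystem_measurableSet.prod isPiSystem_pi) ?_ (by simp)
  · exact ⟨fun _ => Set.univ, fun _ => ⟨fun _ => Set.univ, fun _ _ => MeasurableSet.univ, by simp⟩,
      Set.iUnion_const _⟩
  · rintro _ ⟨s, hs, _, ⟨t, ht, rfl⟩, rfl⟩
    have ht' : ∀ k, MeasurableSet (t k) := fun k => ht k (Set.mem_univ k)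
    rw [h s t hs ht', Measure.compProd_apply_prod hs (MeasurableSet.univ_pi ht')]
    simp only [Kernel.iidPower_apply, Measure.pi_pi]

/-- A second moment is squared mean plus variance, and averaging $K$ independent copies divides the
variance by $K$. -/
lemma integral_sub_mean_sq_pi {ν : Measure β} [IsProbabilityMeasure ν] {f : β → ℝ}
    (hf : MemLp f 2 ν) {K : ℕ} (hK : 1 ≤ K) (c : ℝ) :
    Integrable (fun y : Fin K → β => (c - 1 / (K : ℝ) * ∑ k, f (y k)) ^ 2)
      (Measure.pi fun _ => ν) ∧
    ∫ y : Fin K → β, (c - 1 / (K : ℝ) * ∑ k, f (y k)) ^ 2 ∂(Measure.pi fun _ => ν) =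
      (c - ∫ y, f y ∂ν) ^ 2 + 1 / (K : ℝ) * Var[f; ν] := by
  have hK0 : (K : ℝ) ≠ 0 := by positivity
  have hfk : ∀ k, MemLp (fun y : Fin K → β => f (y k)) 2 (Measure.pi fun _ => ν) := fun k =>
    hf.comp_measurePreserving (measurePreserving_eval (fun _ => ν) k)
  have hsum : MemLp (fun y : Fin K → β => ∑ k, f (y k)) 2 (Measure.pi fun _ => ν) :=
    memLp_finsetSum _ fun k _ => hfk k
  have hW : MemLp (fun y : Fin K → β => c - 1 / (K : ℝ) * ∑ k, f (y k)) 2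
      (Measure.pi fun _ => ν) := (memLp_const c).sub (hsum.const_mul _)
  refine ⟨hW.integrable_sq, ?_⟩
  have h1 := variance_eq_sub hW
  have hmean : ∫ y : Fin K → β, c - 1 / (K : ℝ) * ∑ k, f (y k) ∂(Measure.pi fun _ => ν) =
      c - ∫ y, f y ∂ν := by
    rw [integral_sub (integrable_const c) ((hsum.integrable (by norm_num)).const_mul _),
      integral_const_mul, integral_finsetSum _ fun k _ => (hfk k).integrable (by norm_num)]
    simp only [integral_comp_eval (μ := fun _ : Fin K => ν) hf.aestronglyMeasurable]
    simp [hK0]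
  have hvar : Var[fun y : Fin K → β => c - 1 / (K : ℝ) * ∑ k, f (y k); Measure.pi fun _ => ν] =
      1 / (K : ℝ) * Var[f; ν] := by
    rw [variance_const_sub (hsum.const_mul _).aestronglyMeasurable, variance_const_mul]
    have := variance_sum_pi (μ := fun _ : Fin K => ν) (X := fun _ => f) fun _ => hf
    rw [Finset.sum_fn] at this
    rw [this]
    simp only [Finset.sum_const, Finset.card_univ, Fintype.card_fin, nsmul_eq_mul]
    field_simp
  rw [hmean, hvar] at h1
  simp only [Pi.pow_apply] at h1
  linarith

variable {ν : Measure α} [IsProbabilityMeasure ν] {κ : Kernel α β} [IsMarkovKernel κ] {f : β → ℝ}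

lemma ae_memLp_two_of_integrable_sq_compProd (hf : Measurable f)
    (hf2 : Integrable (fun z : α × β => f z.2 ^ 2) (ν ⊗ₘ κ)) :
    ∀ᵐ x ∂ν, MemLp f 2 (κ x) := by
  filter_upwards [((Measure.integrable_compProd_iff hf2.1).1 hf2).1] with x hx
  exact (memLp_two_iff_integrable_sq hf.aestronglyMeasurable).2 hx

lemma aestronglyMeasurable_variance_kernel (hf : Measurable f)
    (hf2 : Integrable (fun z : α × β => f z.2 ^ 2) (ν ⊗ₘ κ)) :
    AEStronglyMeasurable (fun x => Var[f; κ x]) ν := by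
  have h1 : StronglyMeasurable fun x => ∫ y, (f ^ 2) y ∂κ x - (∫ y, f y ∂κ x) ^ 2 :=
    (StronglyMeasurable.integral_kernel (hf.pow_const 2).stronglyMeasurable).sub
      (hf.stronglyMeasurable.integral_kernel.pow 2)
  refine h1.aestronglyMeasurable.congr ?_
  filter_upwards [ae_memLp_two_of_integrable_sq_compProd hf hf2] with x hx
  exact (variance_eq_sub hx).symm

lemma memLp_two_comp_eval_compProd_iidPower (hf : Measurable f)
    (hf2 : Integrable (fun z : α × β => f z.2 ^ 2) (ν ⊗ₘ κ)) {K : ℕ} (k : Fin K) :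
    MemLp (fun z : α × (Fin K → β) => f (z.2 k)) 2 (ν ⊗ₘ κ.iidPower K) := by
  have hm : Measurable fun z : α × (Fin K → β) => f (z.2 k) := by fun_prop
  rw [memLp_two_iff_integrable_sq hm.aestronglyMeasurable,
    Measure.integrable_compProd_iff (hm.pow_const 2).aestronglyMeasurable]
  have h1 := (Measure.integrable_compProd_iff hf2.1).1 hf2
  constructor
  · filter_upwards [h1.1] with x hx
    exact (measurePreserving_eval (fun _ => κ x) k).integrable_comp_of_integrable hx
  · refine h1.2.congr (Eventually.of_forall fun x => ?_)
    exact (integral_comp_eval (μ := fun _ : Fin K => κ x) (i := k) (f := fun y => ‖f y ^ 2‖)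
      (by fun_prop)).symm

/-- Bias-variance decomposition of a weighted nested second moment. -/
lemma integral_nested_sq_mul (hf : Measurable f)
    (hf2 : Integrable (fun z : α × β => f z.2 ^ 2) (ν ⊗ₘ κ)) {K : ℕ} (hK : 1 ≤ K) {a g : α → ℝ}
    (ha : AEStronglyMeasurable a ν) (hg : AEStronglyMeasurable g ν)
    (hint : Integrable (fun z : α × (Fin K → β) =>
      (a z.1 - 1 / (K : ℝ) * ∑ k, f (z.2 k)) ^ 2 * g z.1) (ν ⊗ₘ κ.iidPower K)) :
    Integrable (fun x => (a x - ∫ y, f y ∂κ x) ^ 2 * g x) ν ∧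
    Integrable (fun x => Var[f; κ x] * g x) ν ∧
    ∫ z : α × (Fin K → β), (a z.1 - 1 / (K : ℝ) * ∑ k, f (z.2 k)) ^ 2 * g z.1
      ∂(ν ⊗ₘ κ.iidPower K) =
      ∫ x, (a x - ∫ y, f y ∂κ x) ^ 2 * g x ∂ν + 1 / (K : ℝ) * ∫ x, Var[f; κ x] * g x ∂ν := by
  have hK0 : (0 : ℝ) < K := by positivity
  have hmem := ae_memLp_two_of_integrable_sq_compProd hf hf2
  have hm := (hf.stronglyMeasurable.integral_kernel (κ := κ)).aestronglyMeasurable (μ := ν)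
  have hs := aestronglyMeasurable_variance_kernel hf hf2
  -- The inner integral of the norm equals this sum exactly. Both summands are nonnegative, so the
  -- integrability of the sum controls each one.
  have hnorm : Integrable (fun x =>
      ((a x - ∫ y, f y ∂κ x) ^ 2 + 1 / (K : ℝ) * Var[f; κ x]) * |g x|) ν := by
    refine ((Measure.integrable_compProd_iff hint.1).1 hint).2.congr ?_
    filter_upwards [hmem] with x hx
    simp only [norm_mul, norm_pow, Real.norm_eq_abs, sq_abs]
    rw [integral_mul_const, Kernel.iidPower_apply, (integral_sub_mean_sq_pi hx hK (a x)).2]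
  have h1 : Integrable (fun x => (a x - ∫ y, f y ∂κ x) ^ 2 * g x) ν := by
    refine hnorm.mono' (((ha.sub hm).pow 2).mul hg) (Eventually.of_forall fun x => ?_)
    have := variance_nonneg f (κ x)
    rw [norm_mul, norm_pow, Real.norm_eq_abs, sq_abs, Real.norm_eq_abs]
    gcongr
    exact le_add_of_nonneg_right (by positivity)
  have h2 : Integrable (fun x => Var[f; κ x] * g x) ν := by
    refine (hnorm.const_mul (K : ℝ)).mono' (hs.mul hg) (Eventually.of_forall fun x => ?_)
    have := variance_nonneg f (κ x)
    rw [norm_mul, Real.norm_eq_abs, Real.norm_eq_abs, abs_of_nonneg this, ← mul_assoc]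
    gcongr
    rw [mul_add, ← mul_assoc, mul_one_div_cancel hK0.ne', one_mul]
    exact le_add_of_nonneg_left (by positivity)
  refine ⟨h1, h2, ?_⟩
  rw [Measure.integral_compProd hint, ← integral_const_mul, ← integral_add h1 (h2.const_mul _)]
  refine integral_congr_ae ?_
  filter_upwards [hmem] with x hx
  rw [integral_mul_const, Kernel.iidPower_apply, (integral_sub_mean_sq_pi hx hK (a x)).2]
  ring

/-- The inner integral is the conditional variance; this identifies the variance term of the
decomposition with the entries of $B$. -/
lemma integral_sub_integral_kernel_sq_mul (hf : Measurable f)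
    (hf2 : Integrable (fun z : α × β => f z.2 ^ 2) (ν ⊗ₘ κ)) {g : α → ℝ}
    (hg : AEStronglyMeasurable g ν) (hint : Integrable (fun x => Var[f; κ x] * g x) ν) :
    Integrable (fun z : α × β => (f z.2 - ∫ y, f y ∂κ z.1) ^ 2 * g z.1) (ν ⊗ₘ κ) ∧
    ∫ z : α × β, (f z.2 - ∫ y, f y ∂κ z.1) ^ 2 * g z.1 ∂(ν ⊗ₘ κ) =
      ∫ x, Var[f; κ x] * g x ∂ν := by
  have hmem := ae_memLp_two_of_integrable_sq_compProd hf hf2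
  have hm := (hf.stronglyMeasurable.integral_kernel (κ := κ)).measurable
  have hgc : AEStronglyMeasurable (fun z : α × β => g z.1) (ν ⊗ₘ κ) := by
    refine AEStronglyMeasurable.comp_measurable (f := Prod.fst) ?_ measurable_fst
    rwa [show (ν ⊗ₘ κ).map Prod.fst = ν from Measure.fst_compProd ν κ]
  have hmeas : AEStronglyMeasurable
      (fun z : α × β => (f z.2 - ∫ y, f y ∂κ z.1) ^ 2 * g z.1) (ν ⊗ₘ κ) :=
    (((hf.comp measurable_snd).sub (hm.comp measurable_fst)).pow_const 2).aestronglyMeasurable.mul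
      hgc
  have hI : Integrable (fun z : α × β => (f z.2 - ∫ y, f y ∂κ z.1) ^ 2 * g z.1) (ν ⊗ₘ κ) := by
    rw [Measure.integrable_compProd_iff hmeas]
    constructor
    · filter_upwards [hmem] with x hx
      exact ((hx.sub (memLp_const _)).integrable_sq).mul_const _
    · refine hint.norm.congr (Eventually.of_forall fun x => ?_)
      simp only [norm_mul, norm_pow, Real.norm_eq_abs, sq_abs, integral_mul_const]
      rw [abs_of_nonneg (variance_nonneg _ _), variance_eq_integral hf.aemeasurable]
  refine ⟨hI, ?_⟩
  rw [Measure.integral_compProd hI]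
  refine integral_congr_ae (Eventually.of_forall fun x => ?_)
  simp only [integral_mul_const]
  rw [variance_eq_integral hf.aemeasurable]

end IIDPower

/-! ### Derivatives and domination of a squared residual. -/

section SquaredResidual

variable {E : Type*} [NormedAddCommGroup E] [NormedSpace ℝ E]

lemma fderiv_fun_sq {f : E → ℝ} {x : E} (hf : DifferentiableAt ℝ f x) :
    fderiv ℝ (fun y => f y ^ 2) x = (2 * f x) • fderiv ℝ f x := by
  refine (hf.hasFDerivAt.pow 2).fderiv.trans ?_
  simp

lemma fderiv_fderiv_fun_sq {f : E → ℝ} {U : Set E} (hU : IsOpen U) (hf : ContDiffOn ℝ 2 f U)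
    {x : E} (hx : x ∈ U) :
    fderiv ℝ (fderiv ℝ fun y => f y ^ 2) x =
      (2 * f x) • fderiv ℝ (fderiv ℝ f) x +
        ((2 : ℝ) • fderiv ℝ f x).smulRight (fderiv ℝ f x) := by
  have h1 : fderiv ℝ (fun y => f y ^ 2) =ᶠ[𝓝 x] fun y => (2 * f y) • fderiv ℝ f y := by
    filter_upwards [hU.mem_nhds hx] with y hy
      using fderiv_fun_sq (hf.differentiableAt_of_isOpen hU hy)
  rw [h1.fderiv_eq]
  exact (((hf.differentiableAt_of_isOpen hU hx).hasFDerivAt.const_mul 2).fun_smul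
    (hf.differentiableAt_fderiv_of_isOpen hU hx).hasFDerivAt).fderiv

lemma norm_gradient {F : Type*} [NormedAddCommGroup F] [InnerProductSpace ℝ F] [CompleteSpace F]
    (f : F → ℝ) (x : F) : ‖gradient f x‖ = ‖fderiv ℝ f x‖ := by
  rw [gradient, LinearIsometryEquiv.norm_map]

lemma norm_iteratedFDeriv_two (f : E → ℝ) (x : E) :
    ‖iteratedFDeriv ℝ 2 f x‖ = ‖fderiv ℝ (fderiv ℝ f) x‖ := by
  rw [← norm_iteratedFDeriv_fderiv, norm_iteratedFDeriv_one]

/-- The derivatives of $\rho^2$ are $2\rho\rho'$ and $2\rho\rho''+2\rho'\otimes\rho'$. Each term of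
the dominating function is a product of two $L^2$ envelopes, hence integrable. -/
lemma isRegularCriterion_sq {S : Type*} [MeasurableSpace S] {q : ℕ} {μ : Measure S}
    {C : Set (EuclideanSpace ℝ (Fin q))} {ρ : EuclideanSpace ℝ (Fin q) → S → ℝ}
    {R M₁ M₂ : S → ℝ} (hm : ∀ θ, AEStronglyMeasurable (ρ θ) μ)
    (hc : ∀ᵐ z ∂μ, ContinuousOn (fun θ => ρ θ z) C)
    (hd : ∀ᵐ z ∂μ, ContDiffOn ℝ 2 (fun θ => ρ θ z) (interior C))
    (hR : MemLp R 2 μ) (hM₁ : MemLp M₁ 2 μ) (hM₂ : MemLp M₂ 2 μ)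
    (hR0 : ∀ z, 0 ≤ R z) (hM₁0 : ∀ z, 0 ≤ M₁ z) (hM₂0 : ∀ z, 0 ≤ M₂ z)
    (hbR : ∀ᵐ z ∂μ, ∀ θ ∈ C, ‖ρ θ z‖ ≤ R z)
    (hb₁ : ∀ᵐ z ∂μ, ∀ θ ∈ interior C, ‖fderiv ℝ (fun θ => ρ θ z) θ‖ ≤ M₁ z)
    (hb₂ : ∀ᵐ z ∂μ, ∀ θ ∈ interior C, ‖fderiv ℝ (fderiv ℝ fun θ => ρ θ z) θ‖ ≤ M₂ z) :
    IsRegularCriterion μ C (fun θ z => ρ θ z ^ 2)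
      (fun z => R z ^ 2 + 2 * (R z * M₁ z) + 2 * (R z * M₂ z) + 2 * M₁ z ^ 2) where
  aestronglyMeasurable θ := (hm θ).pow 2
  continuousOn := by filter_upwards [hc] with z hz using hz.pow 2
  contDiffOn := by filter_upwards [hd] with z hz using hz.pow 2
  integrable := ((hR.integrable_sq.add ((hR.integrable_mul hM₁).const_mul 2)).add
    ((hR.integrable_mul hM₂).const_mul 2)).add (hM₁.integrable_sq.const_mul 2)
  bound := by
    filter_upwards [hbR] with z hz θ hθ
    have h1 := pow_le_pow_left₀ (norm_nonneg _) (hz θ hθ) 2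
    have h2 := mul_nonneg (hR0 z) (hM₁0 z)
    have h3 := mul_nonneg (hR0 z) (hM₂0 z)
    rw [norm_pow]
    linarith [sq_nonneg (M₁ z)]
  bound_fderiv := by
    filter_upwards [hbR, hb₁, hd] with z hz hz1 hdz θ hθ
    rw [fderiv_fun_sq (hdz.differentiableAt_of_isOpen isOpen_interior hθ), norm_smul, norm_mul,
      Real.norm_ofNat]
    have h1 := mul_le_mul (hz θ (interior_subset hθ)) (hz1 θ hθ) (norm_nonneg _) (hR0 z)
    have h3 := mul_nonneg (hR0 z) (hM₂0 z)
    linarith [sq_nonneg (M₁ z), sq_nonneg (R z)]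
  bound_fderiv_fderiv := by
    filter_upwards [hbR, hb₁, hb₂, hd] with z hz hz1 hz2 hdz θ hθ
    rw [fderiv_fderiv_fun_sq isOpen_interior hdz hθ]
    refine (ContinuousLinearMap.opNorm_add_le _ _).trans ?_
    rw [ContinuousLinearMap.norm_smulRight_apply, norm_smul, norm_smul, norm_mul, Real.norm_ofNat]
    have h1 := mul_le_mul (hz θ (interior_subset hθ)) (hz2 θ hθ) (ContinuousLinearMap.opNorm_nonneg _) (hR0 z)
    have h2 := mul_le_mul (hz1 θ hθ) (hz1 θ hθ) (norm_nonneg _) (hM₁0 z)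
    have h3 := mul_nonneg (hR0 z) (hM₁0 z)
    linarith [sq_nonneg (R z)]

end SquaredResidual

/-! ### The blocks as an iid sample. -/

section NestedSample

variable {Ω : Type*} [MeasurableSpace Ω] {P : Measure Ω} [IsProbabilityMeasure P] {d p : ℕ}
  {X : Ω → EuclideanSpace ℝ (Fin d)} {Y : Ω → EuclideanSpace ℝ (Fin p)}
  {Xs : ℕ → Ω → EuclideanSpace ℝ (Fin d)} {Ys : ℕ → ℕ → Ω → EuclideanSpace ℝ (Fin p)}

lemma IsNestedSample.isIIDSample (hs : IsNestedSample P X Y Xs Ys) (hX : Measurable X) (K : ℕ) :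
    IsIIDSample P (P.map X ⊗ₘ (condDistrib Y X P).iidPower K)
      (fun i ω => (Xs i ω, fun k : Fin K => Ys i k ω)) := by
  have hmeas : ∀ i, Measurable fun ω => (Xs i ω, fun k : Fin K => Ys i k ω) := fun i =>
    (hs.measurable_outer i).prodMk (measurable_pi_lambda _ fun k => hs.measurable_inner i k)
  have : IsProbabilityMeasure (P.map X) := Measure.isProbabilityMeasure_map hX.aemeasurable
  refine ⟨fun i => (hmeas i).aemeasurable, fun i => ?_, ?_⟩
  · have := Measure.isProbabilityMeasure_map (μ := P) (hmeas i).aemeasurable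
    refine Measure.eq_compProd_iidPower fun s t hs' ht => ?_
    rw [Measure.map_apply (hmeas i) (hs'.prod (MeasurableSet.univ_pi ht))]
    -- The padding by `Set.univ` is never read, since the law for $n=K$ involves only $k<K$.
    have h1 := hs.block_law i K s (fun k => if h : k < K then t ⟨k, h⟩ else Set.univ) hs'
      (fun k => by
        by_cases h : k < K
        · simpa [h] using ht ⟨k, h⟩
        · simp [h])
    simp only [Finset.prod_range, Fin.is_lt, dif_pos, Fin.eta] at h1
    rw [← h1]
    congr 1
    ext ω
    simp only [Set.mem_preimage, Set.mem_prod, Set.mem_pi, Set.mem_univ, true_imp_iff,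
      Set.mem_ofPred_eq, and_congr_right_iff]
    intro _
    constructor
    · intro h k hk
      simpa [hk] using h ⟨k, hk⟩
    · intro h k
      simpa using h k k.2
  · exact hs.indep.comp (fun _ z => (z.1, fun k : Fin K => z.2 k)) fun _ => by fun_prop

end NestedSample

/-- Scaling by $2$ multiplies the covariance by $2^2$. It reconciles the two Gaussian normalizations
in the final limits. -/
lemma multivariateGaussian_zero_four_smul {q : ℕ} {M : Matrix (Fin q) (Fin q) ℝ}
    (hM : M.PosSemidef) :
    (multivariateGaussian 0 M).map (fun g : EuclideanSpace ℝ (Fin q) => (2 : ℝ) • g) =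
      multivariateGaussian 0 ((4 : ℝ) • M) := by
  have : IsProbabilityMeasure
      ((multivariateGaussian 0 M).map fun g : EuclideanSpace ℝ (Fin q) => (2 : ℝ) • g) :=
    Measure.isProbabilityMeasure_map (by fun_prop)
  refine Measure.ext_of_charFun ?_
  ext t
  rw [charFun_map_smul, charFun_multivariateGaussian hM,
    charFun_multivariateGaussian (hM.smul (by norm_num))]
  simp only [inner_zero_right, WithLp.ofLp_smul, Matrix.mulVec_smul, Matrix.smul_mulVec,
    dotProduct_smul, smul_dotProduct, smul_eq_mul]
  congr 3
  push_cast
  ring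

/-! ### Regularity of the nested criterion. -/

section NestedCriterion

lemma aestronglyMeasurable_fderiv_of_contDiffOn {α : Type*} [MeasurableSpace α]
    {ν : Measure α} {q : ℕ} {φ : EuclideanSpace ℝ (Fin q) → α → ℝ}
    {C : Set (EuclideanSpace ℝ (Fin q))} (hφ : ∀ θ, Measurable (φ θ))
    (hC2 : ∀ᵐ x ∂ν, ContDiffOn ℝ 2 (fun θ => φ θ x) (interior C))
    {θ : EuclideanSpace ℝ (Fin q)} (hθ : θ ∈ interior C) :
    AEStronglyMeasurable (fun x => fderiv ℝ (fun θ => φ θ x) θ) ν := by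
  refine aestronglyMeasurable_fderiv_param isOpen_interior hθ
    (fun θ _ => (hφ θ).aestronglyMeasurable) ?_
  filter_upwards [hC2] with x hx using hx.differentiableAt_of_isOpen isOpen_interior hθ

variable {α β : Type*} [MeasurableSpace α] [MeasurableSpace β]
  {ν : Measure α} [IsProbabilityMeasure ν] {κ : Kernel α β} [IsMarkovKernel κ] {f : β → ℝ}

lemma memLp_two_mean_compProd_iidPower (hf : Measurable f)
    (hf2 : Integrable (fun z : α × β => f z.2 ^ 2) (ν ⊗ₘ κ)) (K : ℕ) :
    MemLp (fun z : α × (Fin K → β) => 1 / (K : ℝ) * ∑ k, f (z.2 k)) 2 (ν ⊗ₘ κ.iidPower K) := by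
  have h1 : MemLp (fun z : α × (Fin K → β) => ∑ k, f (z.2 k)) 2 (ν ⊗ₘ κ.iidPower K) :=
    memLp_finsetSum _ fun k _ => memLp_two_comp_eval_compProd_iidPower hf hf2 k
  exact h1.const_mul _

lemma memLp_comp_fst_compProd {γ F : Type*} [MeasurableSpace γ] [NormedAddCommGroup F]
    {η : Kernel α γ} [IsMarkovKernel η] {M : α → F} {r : ENNReal} (hM : MemLp M r ν) :
    MemLp (fun z : α × γ => M z.1) r (ν ⊗ₘ η) :=
  MemLp.comp_of_map (f := Prod.fst)
    (by rwa [show (ν ⊗ₘ η).map Prod.fst = ν from Measure.fst_compProd ν η])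
    measurable_fst.aemeasurable

lemma aestronglyMeasurable_comp_fst_compProd {γ F : Type*} [MeasurableSpace γ]
    [TopologicalSpace F] {η : Kernel α γ} [IsMarkovKernel η] {M : α → F}
    (hM : AEStronglyMeasurable M ν) :
    AEStronglyMeasurable (fun z : α × γ => M z.1) (ν ⊗ₘ η) :=
  AEStronglyMeasurable.comp_measurable (f := Prod.fst)
    (by rwa [show (ν ⊗ₘ η).map Prod.fst = ν from Measure.fst_compProd ν η]) measurable_fst

lemma ae_comp_fst_compProd {γ : Type*} [MeasurableSpace γ]
    {η : Kernel α γ} [IsMarkovKernel η] {r : α → Prop} (hr : ∀ᵐ x ∂ν, r x) :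
    ∀ᵐ z ∂(ν ⊗ₘ η), r z.1 :=
  ae_of_ae_map measurable_fst.aemeasurable
    (by rwa [show (ν ⊗ₘ η).map Prod.fst = ν from Measure.fst_compProd ν η])

variable {q : ℕ} {φ : EuclideanSpace ℝ (Fin q) → α → ℝ} {C : Set (EuclideanSpace ℝ (Fin q))}

/-- The residual differs from $\varphi$ by a square integrable term free of $\theta$, so its
derivatives are those of $\varphi$, with the same envelopes. -/
lemma exists_isRegularCriterion_nested (hf : Measurable f)
    (hf2 : Integrable (fun z : α × β => f z.2 ^ 2) (ν ⊗ₘ κ)) (K : ℕ)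
    (hφ : ∀ θ, Measurable (φ θ)) (hφν : ∀ θ, MemLp (φ θ) 2 ν)
    (hsup : ∫⁻ x, ⨆ θ ∈ C, ENNReal.ofReal (φ θ x ^ 2) ∂ν < ⊤)
    (hcont : ∀ᵐ x ∂ν, ContinuousOn (fun θ => φ θ x) C)
    (hC2 : ∀ᵐ x ∂ν, ContDiffOn ℝ 2 (fun θ => φ θ x) (interior C))
    (hsup_grad : ∫⁻ x, ⨆ θ ∈ interior C,
      ENNReal.ofReal (‖gradient (fun ϑ => φ ϑ x) θ‖ ^ 2) ∂ν < ⊤)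
    (hsup_hess : ∫⁻ x, ⨆ θ ∈ interior C,
      ENNReal.ofReal (‖iteratedFDeriv ℝ 2 (fun ϑ => φ ϑ x) θ‖ ^ 2) ∂ν < ⊤) :
    ∃ D, IsRegularCriterion (ν ⊗ₘ κ.iidPower K) C
      (fun θ z => (φ θ z.1 - 1 / (K : ℝ) * ∑ k, f (z.2 k)) ^ 2) D := by
  have hd1 : ∀ θ ∈ interior C, AEStronglyMeasurable (fun x => fderiv ℝ (fun θ => φ θ x) θ) ν :=
    fun θ hθ => aestronglyMeasurable_fderiv_of_contDiffOn hφ hC2 hθ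
  have hd2 : ∀ θ ∈ interior C, AEStronglyMeasurable
      (fun x => fderiv ℝ (fderiv ℝ fun θ => φ θ x) θ) ν := fun θ hθ => by
    refine aestronglyMeasurable_fderiv_param (F := fun θ x => fderiv ℝ (fun θ => φ θ x) θ)
      isOpen_interior hθ hd1 ?_
    filter_upwards [hC2] with x hx using hx.differentiableAt_fderiv_of_isOpen isOpen_interior hθ
  have hc1 : ∀ᵐ x ∂ν, ContinuousOn (fun θ => fderiv ℝ (fun θ => φ θ x) θ) (interior C) := by
    filter_upwards [hC2] with x hx
      using (hx.contDiffOn_fderiv_of_isOpen isOpen_interior).continuousOn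
  have hc2 : ∀ᵐ x ∂ν, ContinuousOn (fun θ => fderiv ℝ (fderiv ℝ fun θ => φ θ x) θ)
      (interior C) := by
    filter_upwards [hC2] with x hx
      using hx.continuousOn_fderiv_fderiv_of_isOpen isOpen_interior
  obtain ⟨M₀, hM₀, hM₀0, hb₀⟩ := exists_memLp_two_bound (F := φ)
    (fun θ _ => (hφ θ).aestronglyMeasurable) hcont
    (by simpa only [Real.norm_eq_abs, sq_abs] using hsup)
  simp only [norm_gradient] at hsup_grad
  simp only [norm_iteratedFDeriv_two] at hsup_hess
  obtain ⟨M₁, hM₁, hM₁0, hb₁⟩ := exists_memLp_two_bound hd1 hc1 hsup_grad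
  obtain ⟨M₂, hM₂, hM₂0, hb₂⟩ : ∃ M₂ : α → ℝ, MemLp M₂ 2 ν ∧ (∀ z, 0 ≤ M₂ z) ∧
      ∀ᵐ z ∂ν, ∀ θ ∈ interior C, ‖fderiv ℝ (fderiv ℝ fun θ => φ θ z) θ‖ ≤ M₂ z :=
    exists_memLp_two_bound (F := fun θ x => fderiv ℝ (fderiv ℝ fun θ => φ θ x) θ) hd2 hc2
      hsup_hess
  have havg := memLp_two_mean_compProd_iidPower hf hf2 K
  have hfd : ∀ c x, (fderiv ℝ fun θ => φ θ x - c) = fderiv ℝ fun θ => φ θ x := fun c x => by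
    ext1 θ
    exact fderiv_sub_const _
  refine ⟨_, isRegularCriterion_sq
    (R := fun z => M₀ z.1 + |1 / (K : ℝ) * ∑ k, f (z.2 k)|) (M₁ := fun z => M₁ z.1)
    (M₂ := fun z => M₂ z.1)
    (fun θ => ((memLp_comp_fst_compProd (hφν θ)).sub havg).aestronglyMeasurable) ?_ ?_
    ((memLp_comp_fst_compProd hM₀).add havg.abs) (memLp_comp_fst_compProd hM₁)
    (memLp_comp_fst_compProd hM₂)
    (fun z => add_nonneg (hM₀0 _) (abs_nonneg _)) (fun z => hM₁0 _) (fun z => hM₂0 _) ?_ ?_ ?_⟩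
  · filter_upwards [ae_comp_fst_compProd hcont] with z hz using hz.sub continuousOn_const
  · filter_upwards [ae_comp_fst_compProd hC2] with z hz using hz.sub contDiffOn_const
  · filter_upwards [ae_comp_fst_compProd hb₀] with z hz θ hθ
    exact (norm_sub_le _ _).trans (add_le_add (hz θ hθ) le_rfl)
  · filter_upwards [ae_comp_fst_compProd hb₁] with z hz θ hθ
    rw [hfd]
    exact hz θ hθ
  · filter_upwards [ae_comp_fst_compProd hb₂] with z hz θ hθ
    rw [hfd]
    exact hz θ hθ

end NestedCriterion

/-! ### The nested regression theorem. -/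

theorem mainTheorem3 {Ω : Type*} [MeasurableSpace Ω] (P : Measure Ω) [IsProbabilityMeasure P]
    (d p q : ℕ)
    -- the pair `(X, Y)`, the function `f` and the family `φ(θ, ·)`
    (X : Ω → EuclideanSpace ℝ (Fin d)) (hX : Measurable X)
    (Y : Ω → EuclideanSpace ℝ (Fin p)) (hY : Measurable Y)
    (f : EuclideanSpace ℝ (Fin p) → ℝ) (hf : Measurable f)
    (hfY : MemLp (fun ω => f (Y ω)) 2 P)
    (φ : EuclideanSpace ℝ (Fin q) → EuclideanSpace ℝ (Fin d) → ℝ)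
    (hφ : ∀ θ, Measurable (φ θ))
    (hφX : ∀ θ, MemLp (fun ω => φ θ (X ω)) 2 P)
    -- the nested sample
    (Xs : ℕ → Ω → EuclideanSpace ℝ (Fin d)) (Ys : ℕ → ℕ → Ω → EuclideanSpace ℝ (Fin p))
    (hsample : IsNestedSample P X Y Xs Ys)
    -- the compact parameter set, and the assumptions on it
    (C : Set (EuclideanSpace ℝ (Fin q))) (hC : IsCompact C)
    (hsup : ∫⁻ x, ⨆ θ ∈ C, ENNReal.ofReal (φ θ x ^ 2) ∂(P.map X) < ⊤)
    (hcont : ∀ᵐ x ∂(P.map X), ContinuousOn (fun θ => φ θ x) C)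
    (θstar : EuclideanSpace ℝ (Fin q)) (hθstar : θstar ∈ interior C)
    (hmin : ∀ θ ∈ C, θ ≠ θstar → vInf P X Y f φ θstar < vInf P X Y f φ θ)
    (hC2 : ∀ᵐ x ∂(P.map X), ContDiffOn ℝ 2 (fun θ => φ θ x) (interior C))
    (hsup_grad : ∫⁻ x, ⨆ θ ∈ interior C,
      ENNReal.ofReal (‖gradient (fun ϑ => φ ϑ x) θ‖ ^ 2) ∂(P.map X) < ⊤)
    (hsup_hess : ∫⁻ x, ⨆ θ ∈ interior C,
      ENNReal.ofReal (‖iteratedFDeriv ℝ 2 (fun ϑ => φ ϑ x) θ‖ ^ 2) ∂(P.map X) < ⊤)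
    -- the moment condition at `θstar`; every block `(X_i, (Y_i^{(k)})_k)` has the same law
    (K : ℕ) (hK : 1 ≤ K)
    (hmoment : Integrable (fun ω => nestedResidual f φ K θstar (Xs 0 ω) (fun k => Ys 0 k ω) ^ 2 *
      ‖gradient (fun ϑ => φ ϑ (Xs 0 ω)) θstar‖ ^ 2) P)
    -- the Hessian of the limiting criterion, and the matrix `Γ^K = A + B / K`
    (H : Matrix (Fin q) (Fin q) ℝ) (hH : H = hessianMatrix (vInf P X Y f φ) θstar)
    (hHpos : H.PosDef)
    (A B Γ : Matrix (Fin q) (Fin q) ℝ)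
    (hA : A = expectMatrix P (randA P X Y f φ θstar))
    (hB : B = expectMatrix P (randB P X Y f φ θstar))
    (hΓ : Γ = A + (1 / (K : ℝ)) • B)
    -- the estimator
    (θhat : ℕ → Ω → EuclideanSpace ℝ (Fin q))
    (hθhat_meas : ∀ N, 1 ≤ N → AEMeasurable (θhat N) P)
    (hθhat : ∀ N, 1 ≤ N → ∀ᵐ ω ∂P, θhat N ω ∈ C ∧
      IsMinOn (vEmp f φ K N (fun i => Xs i ω) (fun i k => Ys i k ω)) C (θhat N ω)) :
    (∀ i j, Integrable (fun ω => randA P X Y f φ θstar ω i j) P) ∧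
    (∀ i j, Integrable (fun ω => randB P X Y f φ θstar ω i j) P) ∧
    A.PosSemidef ∧ B.PosSemidef ∧
    TendstoInDistribution (fun (N : ℕ) ω => √(N : ℝ) • (θhat N ω - θstar)) atTop
      (fun g : EuclideanSpace ℝ (Fin q) => g) (fun _ => P)
      (multivariateGaussian 0 ((4 : ℝ) • (H⁻¹ * Γ * H⁻¹))) ∧
    TendstoInDistribution
      (fun (N : ℕ) ω => (N : ℝ) * (vInf P X Y f φ (θhat N ω) - vInf P X Y f φ θstar)) atTop
      (fun g : EuclideanSpace ℝ (Fin q) => 2 * (g.ofLp ⬝ᵥ (H *ᵥ g.ofLp))) (fun _ => P)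
      (multivariateGaussian 0 (H⁻¹ * Γ * H⁻¹)) := by
  have hν : IsProbabilityMeasure (P.map X) := Measure.isProbabilityMeasure_map hX.aemeasurable
  set κ := condDistrib Y X P
  set μ := P.map X ⊗ₘ κ.iidPower K
  have hφν : ∀ θ, MemLp (φ θ) 2 (P.map X) := fun θ =>
    (memLp_map_measure_iff (hφ θ).aestronglyMeasurable hX.aemeasurable).2 (hφX θ)
  have hpair : P.map X ⊗ₘ κ = P.map fun ω => (X ω, Y ω) := compProd_map_condDistrib hY.aemeasurable
  have hXY : Measurable fun ω => (X ω, Y ω) := hX.prodMk hY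
  have hf2 : Integrable (fun z : EuclideanSpace ℝ (Fin d) × EuclideanSpace ℝ (Fin p) => f z.2 ^ 2)
      (P.map X ⊗ₘ κ) := by
    rw [hpair]
    exact (integrable_map_measure
      (hf.comp measurable_snd |>.pow_const 2).aestronglyMeasurable hXY.aemeasurable).2 hfY.integrable_sq
  have hZ : IsIIDSample P μ fun i ω => (Xs i ω, fun k : Fin K => Ys i k ω) :=
    hsample.isIIDSample hX K
  have hZm : Measurable fun ω => (Xs 0 ω, fun k : Fin K => Ys 0 k ω) :=
    (hsample.measurable_outer 0).prodMk (measurable_pi_lambda _ fun k => hsample.measurable_inner 0 k)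
  obtain ⟨D, hr⟩ := exists_isRegularCriterion_nested (κ := κ) hf hf2 K hφ hφν hsup hcont hC2
    hsup_grad hsup_hess
  let ρ : EuclideanSpace ℝ (Fin q) →
    EuclideanSpace ℝ (Fin d) × (Fin K → EuclideanSpace ℝ (Fin p)) → ℝ := fun θ z =>
    φ θ z.1 - 1 / (K : ℝ) * ∑ k, f (z.2 k)
  have hres : ∀ θ ω i, nestedResidual f φ K θ (Xs i ω) (fun k => Ys i k ω) =
      ρ θ (Xs i ω, fun k : Fin K => Ys i k ω) := fun θ ω i => by
    simp only [nestedResidual, ρ, Finset.sum_range]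
  -- the limiting criterion
  let m : EuclideanSpace ℝ (Fin d) → ℝ := fun x => ∫ y, f y ∂κ x
  have hmm : StronglyMeasurable m := hf.stronglyMeasurable.integral_kernel
  have hcond : condMean P X Y f =ᵐ[P] fun ω => m (X ω) :=
    condExp_ae_eq_integral_condDistrib hX hY.aemeasurable hf.stronglyMeasurable
      (hfY.integrable (by norm_num))
  -- The bias-variance identity with weight $1$; the additive constant leaves minimizer, Hessian and
  -- increments unchanged.
  have hV : ∀ θ, ∫ z, ρ θ z ^ 2 ∂μ =
      vInf P X Y f φ θ + 1 / (K : ℝ) * ∫ x, Var[f; κ x] ∂(P.map X) := fun θ => by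
    have h1 := (integral_nested_sq_mul (a := φ θ) (g := fun _ => 1) hf hf2 hK
      (hφ θ).aestronglyMeasurable aestronglyMeasurable_const
      (by simpa using ((memLp_comp_fst_compProd (hφν θ)).sub (memLp_two_mean_compProd_iidPower hf hf2 K)).integrable_sq)).2.2
    simp only [mul_one] at h1
    have h2 : vInf P X Y f φ θ = ∫ x, (φ θ x - m x) ^ 2 ∂(P.map X) := by
      have h3 : ∫ x, (φ θ x - m x) ^ 2 ∂(P.map X) = ∫ ω, (φ θ (X ω) - m (X ω)) ^ 2 ∂P :=
        integral_map hX.aemeasurable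
          (((hφ θ).sub hmm.measurable).pow_const 2).aestronglyMeasurable
      rw [vInf, h3]
      refine integral_congr_ae ?_
      filter_upwards [hcond] with ω hω
      rw [hω]
    rw [h2]
    exact h1
  set c := 1 / (K : ℝ) * ∫ x, Var[f; κ x] ∂(P.map X)
  have hminV : ∀ θ ∈ C, θ ≠ θstar → ∫ z, ρ θstar z ^ 2 ∂μ < ∫ z, ρ θ z ^ 2 ∂μ := fun θ hθ hne => by
    rw [hV, hV]
    linarith [hmin θ hθ hne]
  have hHV : H = hessianMatrix (fun θ => ∫ z, ρ θ z ^ 2 ∂μ) θstar := by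
    rw [hH]
    simp only [hV, hessianMatrix, iteratedFDeriv_two_apply]
    have : fderiv ℝ (fun θ => vInf P X Y f φ θ + c) = fderiv ℝ (vInf P X Y f φ) := by
      ext1 θ
      exact fderiv_add_const _
    rw [this]
  -- the gradient at `θstar`
  let grad : EuclideanSpace ℝ (Fin d) → EuclideanSpace ℝ (Fin q) := fun x =>
    gradient (fun ϑ => φ ϑ x) θstar
  have hgradm : AEStronglyMeasurable grad (P.map X) :=
    (InnerProductSpace.toDual ℝ (EuclideanSpace ℝ (Fin q))).symm.continuous.comp_aestronglyMeasurable
      (aestronglyMeasurable_fderiv_of_contDiffOn hφ hC2 hθstar)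
  have hgradi : ∀ i, AEStronglyMeasurable (fun x => grad x i) (P.map X) := fun i =>
    (EuclideanSpace.proj (𝕜 := ℝ) i).continuous.comp_aestronglyMeasurable hgradm
  have hρm : AEStronglyMeasurable (fun z => ρ θstar z ^ 2) μ := hr.aestronglyMeasurable θstar
  have hmom : Integrable (fun z => ρ θstar z ^ 2 * ‖grad z.1‖ ^ 2) μ := by
    rw [← hZ.map_eq 0, integrable_map_measure (by
      rw [hZ.map_eq 0]
      exact hρm.mul (aestronglyMeasurable_comp_fst_compProd (hgradm.norm.pow 2))) hZm.aemeasurable]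
    simp only [hres] at hmoment
    exact hmoment
  have hgsq : ∀ᵐ z ∂μ, fderiv ℝ (fun θ => ρ θ z ^ 2) θstar =
      (2 * ρ θstar z) • fderiv ℝ (fun θ => φ θ z.1) θstar := by
    filter_upwards [ae_comp_fst_compProd hC2] with z hz
    rw [fderiv_fun_sq ((hz.differentiableAt_of_isOpen isOpen_interior hθstar).sub_const _)]
    congr 1
    exact fderiv_sub_const _
  have hL2 : MemLp (fun z => fderiv ℝ (fun θ => ρ θ z ^ 2) θstar) 2 μ := by
    rw [memLp_two_iff_integrable_sq_norm (hr.aestronglyMeasurable_fderiv hθstar)]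
    refine (hmom.const_mul 4).congr ?_
    filter_upwards [hgsq] with z hz
    have h1 : ‖grad z.1‖ = ‖fderiv ℝ (fun θ => φ θ z.1) θstar‖ := norm_gradient _ _
    rw [hz, norm_smul, h1, norm_mul, Real.norm_ofNat, mul_pow, mul_pow,
      Real.norm_eq_abs, sq_abs]
    ring
  have hij : ∀ i j, Integrable (fun z => ρ θstar z ^ 2 * (grad z.1 i * grad z.1 j)) μ :=
    fun i j => by
    refine hmom.mono' (hρm.mul (aestronglyMeasurable_comp_fst_compProd ((hgradi i).mul (hgradi j)))) (Eventually.of_forall fun z => ?_)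
    rw [norm_mul, norm_mul, norm_pow, Real.norm_eq_abs, sq_abs, sq ‖grad z.1‖]
    gcongr <;> exact PiLp.norm_apply_le _ _
  -- With weight $\partial_i\varphi\,\partial_j\varphi$ the two terms are $A_{ij}$ and $B_{ij}/K$.
  have hnest := fun i j => integral_nested_sq_mul (a := φ θstar)
    (g := fun x => grad x i * grad x j) hf hf2 hK (hφ θstar).aestronglyMeasurable
    ((hgradi i).mul (hgradi j)) (hij i j)
  have hvar := fun i j => integral_sub_integral_kernel_sq_mul hf hf2
    ((hgradi i).mul (hgradi j)) (hnest i j).2.1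
  have hcongA : ∀ i j, (fun ω => randA P X Y f φ θstar ω i j) =ᵐ[P]
      fun ω => (φ θstar (X ω) - m (X ω)) ^ 2 * (grad (X ω) i * grad (X ω) j) := fun i j => by
    filter_upwards [hcond] with ω hω
    simp only [randA, weightedGram, Matrix.of_apply, hω, grad]
  have hcongB : ∀ i j, (fun ω => randB P X Y f φ θstar ω i j) =ᵐ[P]
      fun ω => (f (Y ω) - m (X ω)) ^ 2 * (grad (X ω) i * grad (X ω) j) := fun i j => by
    filter_upwards [hcond] with ω hω
    simp only [randB, weightedGram, Matrix.of_apply, hω, grad]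
  have hAint : ∀ i j, Integrable (fun ω => randA P X Y f φ θstar ω i j) P := fun i j =>
    ((integrable_map_measure (hnest i j).1.1 hX.aemeasurable).1 (hnest i j).1).congr
      (hcongA i j).symm
  have hBint : ∀ i j, Integrable (fun ω => randB P X Y f φ θstar ω i j) P := fun i j => by
    have h1 := (hvar i j).1
    rw [hpair] at h1
    exact ((integrable_map_measure h1.1 hXY.aemeasurable).1 h1).congr (hcongB i j).symm
  have hAval : ∀ i j, A i j = ∫ x, (φ θstar x - m x) ^ 2 * (grad x i * grad x j) ∂(P.map X) :=
    fun i j => by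
    rw [integral_map hX.aemeasurable (hnest i j).1.1, hA, expectMatrix, Matrix.of_apply]
    exact integral_congr_ae (hcongA i j)
  have hBval : ∀ i j, B i j = ∫ x, Var[f; κ x] * (grad x i * grad x j) ∂(P.map X) :=
    fun i j => by
    have h1 := (hvar i j).1.1
    rw [hpair] at h1
    refine Eq.trans ?_ (hvar i j).2
    rw [hpair, integral_map hXY.aemeasurable h1, hB, expectMatrix, Matrix.of_apply]
    exact integral_congr_ae (hcongB i j)
  have hgram : ∀ (w : Ω → ℝ) (M : Matrix (Fin q) (Fin q) ℝ),
      (∀ i j, Integrable (fun ω => weightedGram X φ θstar w ω i j) P) →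
      M = expectMatrix P (weightedGram X φ θstar w) → M.PosSemidef := fun w M hw hM => by
    have h1 : ∀ i j ω, weightedGram X φ θstar w ω i j =
        (w ω • grad (X ω)) i * (w ω • grad (X ω)) j := fun i j ω => by
      simp only [weightedGram, Matrix.of_apply, PiLp.smul_apply, smul_eq_mul, grad]
      ring
    refine (posSemidef_integral_outer (μ := P) (v := fun ω => w ω • grad (X ω)) (fun i j => ?_)
      fun i j => ?_).1
    · simpa only [h1] using hw i j
    · simp only [hM, expectMatrix, Matrix.of_apply, h1]
  have hApos : A.PosSemidef := hgram _ A hAint hA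
  have hBpos : B.PosSemidef := hgram _ B hBint hB
  -- The factor $4$ is the square of the $2$ in $\nabla(\rho^2)=2\rho\nabla\varphi$.
  have hQ : ∀ i j, ((4 : ℝ) • Γ) i j = ∫ z, gradient (fun θ => ρ θ z ^ 2) θstar i *
      gradient (fun θ => ρ θ z ^ 2) θstar j ∂μ := fun i j => by
    have h1 : ∫ z, gradient (fun θ => ρ θ z ^ 2) θstar i *
        gradient (fun θ => ρ θ z ^ 2) θstar j ∂μ =
        ∫ z, 4 * (ρ θstar z ^ 2 * (grad z.1 i * grad z.1 j)) ∂μ := by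
      refine integral_congr_ae ?_
      filter_upwards [hgsq] with z hz
      simp only [gradient, hz, map_smul, PiLp.smul_apply, smul_eq_mul, grad]
      ring
    rw [h1, integral_const_mul]
    erw [(hnest i j).2.2]
    rw [← hAval, ← hBval, hΓ]
    simp
  obtain ⟨hres1, hres2⟩ := hr.tendstoInDistribution_minimizer hZ hC hθstar hminV hL2 hHV hHpos hQ
    hθhat_meas (fun N hN => by
      filter_upwards [hθhat N hN] with ω hω
      refine ⟨hω.1, ?_⟩
      have h1 : (fun θ => sampleMean (fun i => (Xs i ω, fun k : Fin K => Ys i k ω)) N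
          fun z => ρ θ z ^ 2) = vEmp f φ K N (fun i => Xs i ω) fun i k => Ys i k ω := by
        ext1 θ
        simp only [sampleMean, vEmp, hres, smul_eq_mul, one_div]
      rw [h1]
      exact hω.2)
  have hΓpos : Γ.PosSemidef := by
    rw [hΓ]
    exact hApos.add (hBpos.smul (by positivity))
  have hSpos : (H⁻¹ * Γ * H⁻¹).PosSemidef := by
    have := hΓpos.mul_mul_conjTranspose_same H⁻¹
    rwa [hHpos.inv.isHermitian.eq] at this
  have hmul : H⁻¹ * ((4 : ℝ) • Γ) * H⁻¹ = (4 : ℝ) • (H⁻¹ * Γ * H⁻¹) := by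
    rw [Matrix.mul_smul, Matrix.smul_mul]
  rw [hmul] at hres1 hres2
  refine ⟨hAint, hBint, hApos, hBpos, hres1, ?_⟩
  have hqm : ∀ a : ℝ, Measurable fun g : EuclideanSpace ℝ (Fin q) =>
      a * (g.ofLp ⬝ᵥ (H *ᵥ g.ofLp)) := fun a => by
    have : Continuous fun g : EuclideanSpace ℝ (Fin q) => a * (g.ofLp ⬝ᵥ (H *ᵥ g.ofLp)) := by
      fun_prop
    exact this.measurable
  have hdiff : ∀ θ, ∫ z, ρ θ z ^ 2 ∂μ - ∫ z, ρ θstar z ^ 2 ∂μ =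
      vInf P X Y f φ θ - vInf P X Y f φ θstar := fun θ => by
    rw [hV, hV]
    ring
  simp only [← hdiff]
  refine hres2.of_map_eq (hqm 2).aemeasurable ?_
  -- The limit $\frac12g^THg$ under covariance $4H^{-1}\Gamma H^{-1}$ is rewritten with $g=2G$:
  -- $\frac12(2G)^TH(2G)=2G^THG$.
  rw [← multivariateGaussian_zero_four_smul hSpos, Measure.map_map (hqm _) (by fun_prop)]
  congr 1
  ext g
  simp only [Function.comp_apply, WithLp.ofLp_smul, Matrix.mulVec_smul, dotProduct_smul,
    smul_dotProduct, smul_eq_mul]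
  ring
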